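/- Let $\gamma\in\mathbb R$ and let $V:(0,\infty)\to\mathbb R$ be measurable with $\int_0^\infty(1+x)|V(x)|\,dx<\infty$. Let $H=-\frac{d^2}{dx^2}+V$ be the self-adjoint operator in $L^2(\mathbb R_+)$ defined through the quadratic form $\int_0^\infty\left(|u'|^2+V|u|^2\right)dx+\gamma|u(0)|^2$ with form domain $H^1(\mathbb R_+)$ (that is, with the Robin boundary condition $u'(0)=\gamma u(0)$). For $\operatorname{Im}\zeta\ge 0$ let $\theta(\cdot,\zeta)$ be the Jost solution, i.e. the solution of $-u''+Vu=\zeta^2u$ on $[0,\infty)$ with $\theta(x,\zeta)=e^{i\zeta x}(1+o(1))$ and $\theta'(x,\zeta)=e^{i\zeta x}(i\zeta+o(1))$ as $x\to\infty$. Let $w(\zeta)=\gamma\,\theta(0,\zeta)-\theta'(0,\zeta)$ be the Jost function; it is the Wronskian $\varphi'\theta-\theta'\varphi$ of $\theta$ and the regular solution $\varphi$, which solves the same equation with $\varphi(0,\zeta)=1$, $\varphi'(0,\zeta)=\gamma$. A limit phase is a continuous function $\eta:(0,\infty)\to\mathbb R$ such that $$w(k)=a(k)\,e^{i\eta(k)}(\gamma-ik),\qquad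 a(k)=\frac{|w(k)|}{\sqrt{\gamma^2+k^2}},\qquad k>0 .$$ Then $H$ has only finitely many negative eigenvalues, all of them simple; let $N$ be their number. A limit phase exists and can be chosen with $\eta(k)\to0$ as $k\to\infty$. For every limit phase $\eta$ the limits $\eta(0):=\lim_{k\to0+}\eta(k)$ and $\eta(\infty):=\lim_{k\to\infty}\eta(k)$ exist, and the following holds. If $w(0)\neq0$, then $$\eta(\infty)-\eta(0)=\begin{cases}\pi N&\text{if }\gamma>0,\\ \pi\left(N-\tfrac12\right)&\text{if }\gamma=0,\\ \pi(N-1)&\text{if }\gamma<0.\end{cases}$$ If $w(0)=0$, then $$\eta(\infty)-\eta(0)=\begin{cases}\pi\left(N+\tfrac12\right)&\text{if }\gamma>0,\\ \pi N&\text{if }\gamma=0,\\ \pi\left(N-\tfrac12\right)&\text{if }\gamma<0.\end{cases}$$ -/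

import Mathlib

open Set Filter Topology MeasureTheory
open scoped ComplexConjugate

noncomputable section

namespace RobinSchrodinger

/-- Lebesgue measure on the open half-line `(0, ∞)`. -/
abbrev halfLine : Measure ℝ := volume.restrict (Ioi (0 : ℝ))

/-- The complex Hilbert space `L²(ℝ₊)`. -/
abbrev L2 : Type := Lp ℂ 2 halfLine

/-- `u` is the (locally absolutely) continuous representative of an element of the Sobolev space
`H¹(ℝ₊)`, and `u'` is its weak derivative: both are square integrable and `u` is a primitive
of `u'` on `[0, ∞)`.  In particular `u 0` is the boundary value (trace) at `0`. -/
structure IsH1 (u u' : ℝ → ℂ) : Prop where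
  memLp : MemLp u 2 halfLine
  memLp_deriv : MemLp u' 2 halfLine
  eq_integral : ∀ x : ℝ, 0 ≤ x → u x = u 0 + ∫ t in (0 : ℝ)..x, u' t

/-- The sesquilinear form
`h[u, v] = ∫₀^∞ (u' v̄' + V u v̄) dx + γ u(0) v̄(0)`
whose quadratic form is `∫₀^∞ (|u'|² + V |u|²) dx + γ |u(0)|²`. -/
def robinForm (V : ℝ → ℝ) (γ : ℝ) (u u' v v' : ℝ → ℂ) : ℂ :=
  (∫ x in Ioi (0 : ℝ), (u' x * conj (v' x) + (V x : ℂ) * u x * conj (v x)))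
    + (γ : ℂ) * u 0 * conj (v 0)

/-- The graph of the operator `H = -d²/dx² + V` in `L²(ℝ₊)` defined through the form `robinForm`
with form domain `H¹(ℝ₊)`: `HamiltonianGraph V γ f g` means that `f ∈ D(H)` and `H f = g`, i.e.
that `f ∈ H¹(ℝ₊)` and `h[f, v] = ⟨g, v⟩` for all `v ∈ H¹(ℝ₊)`. -/
def HamiltonianGraph (V : ℝ → ℝ) (γ : ℝ) (f g : L2) : Prop :=
  ∃ u u' : ℝ → ℂ, IsH1 u u' ∧ (f : ℝ → ℂ) =ᵐ[halfLine] u ∧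
    ∀ v v' : ℝ → ℂ, IsH1 v v' →
      robinForm V γ u u' v v' = ∫ x in Ioi (0 : ℝ), (g : ℝ → ℂ) x * conj (v x)

/-- `f` is an eigenvector of `H` for the real number `lam`: `f ≠ 0`, `f ∈ D(H)`, `H f = lam f`. -/
def IsEigenvector (V : ℝ → ℝ) (γ lam : ℝ) (f : L2) : Prop :=
  f ≠ 0 ∧ HamiltonianGraph V γ f ((lam : ℂ) • f)

/-- The set of negative eigenvalues of `H`. -/
def negEigenvalues (V : ℝ → ℝ) (γ : ℝ) : Set ℝ :=
  {lam | lam < 0 ∧ ∃ f : L2, IsEigenvector V γ lam f}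

/-- `u` is a solution of `-u'' + V u = ζ² u` on `[0, ∞)`: `u` is differentiable with derivative
`u'` (one-sided at `0`), and `u'` is locally absolutely continuous with `u'' = (V - ζ²) u` almost
everywhere, written as an integral equation. -/
structure IsSolution (V : ℝ → ℝ) (ζ : ℂ) (u u' : ℝ → ℂ) : Prop where
  hasDeriv : ∀ x : ℝ, 0 ≤ x → HasDerivWithinAt u (u' x) (Ici 0) x
  deriv_eq : ∀ x : ℝ, 0 ≤ x → u' x = u' 0 + ∫ t in (0 : ℝ)..x, ((V t : ℂ) - ζ ^ 2) * u t

/-- The Jost solution: the solution `θ` with `θ(x) = e^{iζx} (1 + o(1))` and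
`θ'(x) = e^{iζx} (iζ + o(1))` as `x → ∞`. -/
structure IsJostSolution (V : ℝ → ℝ) (ζ : ℂ) (θ θ' : ℝ → ℂ) : Prop where
  isSolution : IsSolution V ζ θ θ'
  tendsto : Tendsto (fun x : ℝ => Complex.exp (-(Complex.I * ζ * (x : ℂ))) * θ x) atTop (𝓝 1)
  tendsto_deriv : Tendsto (fun x : ℝ => Complex.exp (-(Complex.I * ζ * (x : ℂ))) * θ' x) atTop
    (𝓝 (Complex.I * ζ))

open Classical in
/-- The Jost solution `θ(·, ζ)` together with its derivative `θ'(·, ζ)`. It is determined on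
`[0, ∞)` for `Im ζ ≥ 0` when `(1 + x) V` is integrable. -/
def jostSolution (V : ℝ → ℝ) (ζ : ℂ) : (ℝ → ℂ) × (ℝ → ℂ) :=
  if h : ∃ p : (ℝ → ℂ) × (ℝ → ℂ), IsJostSolution V ζ p.1 p.2 then h.choose else 0

/-- The Jost function `w(ζ) = γ θ(0, ζ) - θ'(0, ζ)`. It is the Wronskian `φ' θ - θ' φ`, evaluated
at `x = 0`, of the Jost solution `θ` and the regular solution `φ`, which is normalized by
`φ(0) = 1` and `φ'(0) = γ`. -/
def jostFunction (V : ℝ → ℝ) (γ : ℝ) (ζ : ℂ) : ℂ :=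
  (γ : ℂ) * (jostSolution V ζ).1 0 - (jostSolution V ζ).2 0

/-- The limit amplitude `a(k) = |w(k)| / √(γ² + k²)`. -/
def limitAmplitude (V : ℝ → ℝ) (γ : ℝ) (k : ℝ) : ℝ :=
  ‖jostFunction V γ (k : ℂ)‖ / Real.sqrt (γ ^ 2 + k ^ 2)

/-- `η` is a continuous branch, on `(0, ∞)`, of the limit phase:
`w(k) = a(k) e^{iη(k)} (γ - ik)` for all `k > 0`. -/
structure IsLimitPhase (V : ℝ → ℝ) (γ : ℝ) (η : ℝ → ℝ) : Prop where
  continuousOn : ContinuousOn η (Ioi 0)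
  eq_polar : ∀ k : ℝ, 0 < k → jostFunction V γ (k : ℂ) =
    (limitAmplitude V γ k : ℂ) * Complex.exp (Complex.I * (η k : ℂ))
      * ((γ : ℂ) - Complex.I * (k : ℂ))

end RobinSchrodinger

end

/-!
Levinson's formula for the Robin problem on the half-line.

The Jost solution is `θ(x, ζ) = e^{iζx} m(x, ζ)`, where `m` solves a Volterra equation whose kernel is
bounded by `t |V(t)|` for all `ζ` in the closed upper half-plane (`jostAmp`,
`isJostSolution_jostAmp`). Its Neumann series therefore converges uniformly, and the Jost function
`w` is continuous on the closed upper half-plane (`continuous_jostFunction`) and asymptotic to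
`1 - iζ` at infinity (`tendsto_jostFunction_div`).

The zeros of `w` in the closed upper half-plane are of the form `iκ` with `κ ≥ 0`
(`jostFunction_ne_zero`), and those with `κ > 0` correspond to the negative eigenvalues `-κ²`
(`negEigenvalues_eq`). They are simple, in the sense that `w(ζ) / (ζ - iκ)` has a nonzero limit: for
`κ > 0` by Green's formula, which expresses `w(ζ)` through `∫ θ(·, ζ) θ(·, iκ)`, and for `κ = 0` by
Green's formula on `[0, X]` with `X` a small multiple of `1 / |ζ|`
(`exists_tendsto_jostFunction_div`, `exists_tendsto_jostFunction_div_zero`). Being isolated and, by the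
asymptotics, bounded, they are finite in number (`finite_zeros_jostFunction`).

Analyticity of `w` and the argument principle are not needed. Dividing `w` by `1 - iζ` and by the
factors `(ζ - iκ) / (ζ + i(κ + 1))` leaves a continuous function `g` without zeros which tends to `1`
at infinity and is real on the imaginary axis (`exists_jostFunction_eq_mul`). Such a `g` has a
continuous logarithm, because the half-plane is simply connected; its argument is constant along the
imaginary axis and small, modulo `2π`, on large quarter circles, so the arguments of `g` at the two
ends of `(0, ∞)` agree (`exists_phase_tendsto_zero`). The change of the limit phase is therefore that of
the explicit factors, whose arguments on `(0, ∞)` are arctangents of `c / k`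
(`tendsto_explicitPhase_zero`).
-/

noncomputable section

namespace RobinSchrodinger

/-! ### Absolutely continuous functions on the half-line -/

/-- `f` is a primitive on `[0, ∞)` of the locally integrable function `f'`; equivalently, `f` is
locally absolutely continuous on `[0, ∞)` with almost everywhere derivative `f'`. -/
structure IsPrim {𝕜 : Type*} [RCLike 𝕜] (f f' : ℝ → 𝕜) : Prop where
  integrable : ∀ x : ℝ, 0 ≤ x → IntervalIntegrable f' volume 0 x
  eq_integral : ∀ x : ℝ, 0 ≤ x → f x = f 0 + ∫ t in (0 : ℝ)..x, f' t

section Prim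

variable {𝕜 : Type*} [RCLike 𝕜] {f f' g g' : ℝ → 𝕜}

theorem absolutelyContinuous_const (c : 𝕜) (a b : ℝ) :
    AbsolutelyContinuousOnInterval (fun _ : ℝ => c) a b :=
  ((LipschitzWith.const (α := ℝ) c).lipschitzOnWith (s := uIcc a b)).absolutelyContinuousOnInterval

theorem absolutelyContinuous_integral {a b : ℝ} (h : IntervalIntegrable f volume a b) :
    AbsolutelyContinuousOnInterval (fun x => ∫ t in a..x, f t) a b := by
  have hre : IntervalIntegrable (fun t => RCLike.re (f t)) volume a b :=
    ⟨h.1.re, h.2.re⟩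
  have him : IntervalIntegrable (fun t => RCLike.im (f t)) volume a b :=
    ⟨h.1.im, h.2.im⟩
  have h1 := (hre.absolutelyContinuousOnInterval_intervalIntegral
    (left_mem_uIcc)).smul (absolutelyContinuous_const (1 : 𝕜) a b)
  have h2 := (him.absolutelyContinuousOnInterval_intervalIntegral
    (left_mem_uIcc)).smul (absolutelyContinuous_const (RCLike.I : 𝕜) a b)
  have h3 := h1.add h2
  have key : ∀ x ∈ uIcc a b, (∫ t in a..x, f t) =
      ((fun x => ∫ t in a..x, RCLike.re (f t)) • (fun _ : ℝ => (1 : 𝕜)) +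
       (fun x => ∫ t in a..x, RCLike.im (f t)) • (fun _ : ℝ => (RCLike.I : 𝕜))) x := by
    intro x hx
    have hax : IntervalIntegrable f volume a x :=
      h.mono_set (uIcc_subset_uIcc left_mem_uIcc hx)
    simp only [Pi.add_apply, Pi.smul_apply', RCLike.real_smul_eq_coe_mul, mul_one]
    rw [← RCLike.re_add_im (∫ t in a..x, f t)]
    congr 2
    · simpa using (RCLike.reCLM (K := 𝕜)).intervalIntegral_comp_comm hax |>.symm
    · congr 1
      simpa using (RCLike.imCLM (K := 𝕜)).intervalIntegral_comp_comm hax |>.symm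
  rw [absolutelyContinuousOnInterval_iff] at h3 ⊢
  intro ε hε
  obtain ⟨δ, hδ, H⟩ := h3 ε hε
  refine ⟨δ, hδ, fun E hE hlt => ?_⟩
  refine lt_of_eq_of_lt (Finset.sum_congr rfl fun i hi => ?_) (H E hE hlt)
  have := hE.1 i hi
  rw [key _ this.1, key _ this.2]

namespace IsPrim

theorem absolutelyContinuous (h : IsPrim f f') {x : ℝ} (hx : 0 ≤ x) :
    AbsolutelyContinuousOnInterval f 0 x := by
  have h3 := (absolutelyContinuous_const (f 0) 0 x).add
    (absolutelyContinuous_integral (h.integrable x hx))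
  rw [absolutelyContinuousOnInterval_iff] at h3 ⊢
  intro ε hε
  obtain ⟨δ, hδ, H⟩ := h3 ε hε
  refine ⟨δ, hδ, fun E hE hlt => ?_⟩
  refine lt_of_eq_of_lt (Finset.sum_congr rfl fun i hi => ?_) (H E hE hlt)
  have := hE.1 i hi
  rw [uIcc_of_le hx] at this
  rw [h.eq_integral _ this.1.1, h.eq_integral _ this.2.1]
  rfl

theorem ae_hasDerivAt (h : IsPrim f f') {x : ℝ} (hx : 0 ≤ x) :
    ∀ᵐ y, y ∈ Ioo 0 x → HasDerivAt f (f' y) y := by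
  filter_upwards [(h.integrable x hx).ae_hasDerivAt_integral] with y hy hyx
  have hy' : y ∈ uIcc 0 x := by rw [uIcc_of_le hx]; exact Ioo_subset_Icc_self hyx
  refine ((hy hy' 0 left_mem_uIcc).const_add (f 0)).congr_of_eventuallyEq ?_
  filter_upwards [lt_mem_nhds hyx.1] with z hz
  exact h.eq_integral z hz.le

theorem continuousOn (h : IsPrim f f') : ContinuousOn f (Ici 0) := by
  intro x hx
  have hx' : (0 : ℝ) ≤ x := hx
  have h1 := (h.absolutelyContinuous (x := x + 1) (by linarith)).continuousOn
  rw [uIcc_of_le (by linarith)] at h1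
  have h2 := h1 x ⟨hx, by linarith⟩
  refine h2.mono_of_mem_nhdsWithin ?_
  have : Iio (x + 1) ∈ 𝓝 x := Iio_mem_nhds (by linarith)
  filter_upwards [self_mem_nhdsWithin, nhdsWithin_le_nhds this] with y hy hy'
  exact ⟨hy, (mem_Iio.1 hy').le⟩

/-- The fundamental theorem of calculus for absolutely continuous functions, as a criterion. -/
theorem of_ae_hasDerivAt
    (hac : ∀ x : ℝ, 0 ≤ x → AbsolutelyContinuousOnInterval f 0 x)
    (hint : ∀ x : ℝ, 0 ≤ x → IntervalIntegrable f' volume 0 x)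
    (hd : ∀ x : ℝ, 0 ≤ x → ∀ᵐ y, y ∈ Ioo 0 x → HasDerivAt f (f' y) y) : IsPrim f f' := by
  refine ⟨hint, fun x hx => ?_⟩
  have h1 : AbsolutelyContinuousOnInterval (fun y => f y - ∫ t in (0 : ℝ)..y, f' t) 0 x :=
    (hac x hx).sub (absolutelyContinuous_integral (hint x hx))
  obtain ⟨C, hC⟩ := h1.const_of_ae_hasDerivAt_zero (by
    have h0 : ∀ᵐ y : ℝ, y ≠ 0 := by simp [ae_iff]
    have h0' : ∀ᵐ y : ℝ, y ≠ x := by simp [ae_iff]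
    filter_upwards [hd x hx, (hint x hx).ae_hasDerivAt_integral, h0, h0'] with y h1 h2 h3 h4 h5
    have h6 := h5
    rw [uIcc_of_le hx] at h6
    have h7 := (h1 ⟨lt_of_le_of_ne h6.1 (Ne.symm h3), lt_of_le_of_ne h6.2 h4⟩).sub
      (h2 h5 0 left_mem_uIcc)
    rw [sub_self] at h7
    exact h7)
  have h2 := hC x right_mem_uIcc
  have h3 := hC 0 left_mem_uIcc
  simp only [intervalIntegral.integral_same, sub_zero] at h2 h3
  rw [h3, ← h2]; ring

/-- The product rule for absolutely continuous functions. -/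
theorem mul (hf : IsPrim f f') (hg : IsPrim g g') :
    IsPrim (fun x => f x * g x) (fun x => f' x * g x + f x * g' x) := by
  refine of_ae_hasDerivAt (fun x hx => ?_) (fun x hx => ?_) (fun x hx => ?_)
  · exact (hf.absolutelyContinuous hx).smul (hg.absolutelyContinuous hx)
  · have hsub : uIcc 0 x ⊆ Ici (0 : ℝ) := by rw [uIcc_of_le hx]; exact Icc_subset_Ici_self
    exact ((hf.integrable x hx).mul_continuousOn (hg.continuousOn.mono hsub)).add
      ((hg.integrable x hx).continuousOn_mul (hf.continuousOn.mono hsub))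
  · filter_upwards [hf.ae_hasDerivAt hx, hg.ae_hasDerivAt hx] with y h1 h2 h3
    exact (h1 h3).mul (h2 h3)

theorem const_mul (c : 𝕜) (hf : IsPrim f f') :
    IsPrim (fun x => c * f x) (fun x => c * f' x) :=
  ⟨fun x hx => (hf.integrable x hx).const_mul c, fun x hx => by
    rw [intervalIntegral.integral_const_mul, hf.eq_integral x hx]; ring⟩

theorem sub (hf : IsPrim f f') (hg : IsPrim g g') :
    IsPrim (fun x => f x - g x) (fun x => f' x - g' x) :=
  ⟨fun x hx => (hf.integrable x hx).sub (hg.integrable x hx), fun x hx => by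
    rw [intervalIntegral.integral_sub (hf.integrable x hx) (hg.integrable x hx),
      hf.eq_integral x hx, hg.eq_integral x hx]; ring⟩

/-- Two functions agreeing on `[0, ∞)`, and two derivatives agreeing almost everywhere there, are
interchangeable. -/
theorem congr (hf : IsPrim f f') (h : ∀ x, 0 ≤ x → f x = g x)
    (h' : ∀ᵐ x ∂volume, 0 < x → f' x = g' x) : IsPrim g g' := by
  have key : ∀ x, 0 ≤ x → ∀ᵐ t ∂volume, t ∈ uIoc 0 x → f' t = g' t := by
    intro x hx
    filter_upwards [h'] with t ht h3
    rw [uIoc_of_le hx] at h3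
    exact ht h3.1
  refine ⟨fun x hx => (hf.integrable x hx).congr_ae ?_, fun x hx => ?_⟩
  · rw [EventuallyEq, ae_restrict_iff' measurableSet_uIoc]
    exact key x hx
  · rw [← h x hx, ← h 0 le_rfl, hf.eq_integral x hx,
      intervalIntegral.integral_congr_ae (key x hx)]

theorem pow (hf : IsPrim f f') (n : ℕ) :
    IsPrim (fun x => f x ^ (n + 1)) (fun x => (n + 1) * (f x ^ n * f' x)) := by
  induction n with
  | zero => simpa using hf
  | succ n ih =>
    refine (ih.mul hf).congr (fun x _ => by ring) (Eventually.of_forall fun x _ => ?_)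
    push_cast; ring

/-- A function differentiable on `[0, ∞)` with continuous derivative is a primitive of it. -/
theorem of_hasDerivWithinAt (hd : ∀ x : ℝ, 0 ≤ x → HasDerivWithinAt f (f' x) (Ici 0) x)
    (hc : ContinuousOn f' (Ici 0)) : IsPrim f f' := by
  have hint : ∀ x : ℝ, 0 ≤ x → IntervalIntegrable f' volume 0 x := fun x hx =>
    (hc.mono (by rw [uIcc_of_le hx]; exact Icc_subset_Ici_self)).intervalIntegrable
  refine ⟨hint, fun x hx => ?_⟩
  rw [intervalIntegral.integral_eq_sub_of_hasDeriv_right_of_le hx (f := f)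
    (fun y hy => ((hd y hy.1).continuousWithinAt).mono Icc_subset_Ici_self)
    (fun y hy => (hd y hy.1.le).mono (fun z hz => hy.1.le.trans (le_of_lt hz))) (hint x hx)]
  ring

theorem sub_eq_integral (hf : IsPrim f f') {x y : ℝ} (hx : 0 ≤ x) (hy : 0 ≤ y) :
    f y - f x = ∫ t in x..y, f' t := by
  rw [hf.eq_integral y hy, hf.eq_integral x hx,
    ← intervalIntegral.integral_add_adjacent_intervals (hf.integrable x hx).symm
      (hf.integrable y hy), intervalIntegral.integral_symm 0 x]
  ring

end IsPrim

/-- Grönwall's lemma with a merely integrable weight, in its uniqueness form. -/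
theorem eq_zero_of_le_integral_mul {q g : ℝ → ℝ} (hq : ∀ x, 0 ≤ q x)
    (hqi : ∀ x, 0 ≤ x → IntervalIntegrable q volume 0 x)
    (hgc : ContinuousOn g (Ici 0)) (hg0 : ∀ x, 0 ≤ x → 0 ≤ g x)
    (hg : ∀ x, 0 ≤ x → g x ≤ ∫ t in (0 : ℝ)..x, q t * g t) :
    ∀ x, 0 ≤ x → g x = 0 := by
  intro X hX
  obtain ⟨M, hM⟩ := isCompact_Icc.exists_bound_of_continuousOn
    (hgc.mono (fun y (hy : y ∈ Icc 0 X) => hy.1))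
  set Q : ℝ → ℝ := fun x => ∫ t in (0 : ℝ)..x, q t with hQ
  have hQp : IsPrim Q q := ⟨hqi, fun x hx => by simp [hQ]⟩
  have hint : ∀ x, 0 ≤ x → IntervalIntegrable (fun t => q t * g t) volume 0 x := fun x hx =>
    (hqi x hx).mul_continuousOn (hgc.mono (by rw [uIcc_of_le hx]; exact Icc_subset_Ici_self))
  have key : ∀ n : ℕ, ∀ x ∈ Icc 0 X, g x ≤ M * (Q x ^ n / n.factorial) := by
    intro n
    induction n with
    | zero => intro x hx; simpa using (le_abs_self _).trans (hM x hx)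
    | succ n ih =>
      intro x hx
      refine (hg x hx.1).trans ?_
      have hp := hQp.pow n
      have h1 : ∫ t in (0 : ℝ)..x, (M / (n + 1).factorial) * ((n + 1) * (Q t ^ n * q t)) =
          M * (Q x ^ (n + 1) / (n + 1).factorial) := by
        have := hp.eq_integral x hx.1
        rw [intervalIntegral.integral_const_mul]
        have hQ0 : Q 0 = 0 := by simp [hQ]
        simp only [hQ0] at this
        rw [show ∫ t in (0 : ℝ)..x, ((n : ℝ) + 1) * (Q t ^ n * q t) = Q x ^ (n + 1) by
          rw [this]; simp]
        ring
      rw [← h1]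
      refine intervalIntegral.integral_mono_on hx.1 (hint x hx.1)
        ((hp.integrable x hx.1).const_mul _) fun t ht => ?_
      have h2 := mul_le_mul_of_nonneg_left (ih t ⟨ht.1, ht.2.trans hx.2⟩) (hq t)
      refine h2.trans_eq ?_
      rw [Nat.factorial_succ]; push_cast
      have : (n.factorial : ℝ) ≠ 0 := by positivity
      field_simp
  have hlim : Tendsto (fun n : ℕ => M * (Q X ^ n / n.factorial)) atTop (𝓝 (M * 0)) :=
    (FloorSemiring.tendsto_pow_div_factorial_atTop (Q X)).const_mul M
  rw [mul_zero] at hlim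
  exact le_antisymm (ge_of_tendsto' hlim fun n => key n X ⟨hX, le_rfl⟩) (hg0 X hX)

end Prim

/-! ### The potential, tail integrals and the kernel of the Volterra equation -/

section Potential

variable {V : ℝ → ℝ}

theorem integrableOn_potential (hV : IntegrableOn (fun x : ℝ => (1 + x) * V x) (Ioi 0) volume) :
    IntegrableOn V (Ioi 0) volume := by
  have h1 : ∀ᵐ x ∂(volume.restrict (Ioi (0 : ℝ))), (1 + x)⁻¹ * ((1 + x) * V x) = V x := by
    filter_upwards [ae_restrict_mem measurableSet_Ioi] with x hx
    have : (1 + x) ≠ 0 := by have : (0 : ℝ) < x := hx; positivity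
    field_simp
  refine (Integrable.congr ?_ h1)
  refine hV.bdd_mul (c := 1) (by fun_prop) ?_
  filter_upwards [ae_restrict_mem measurableSet_Ioi] with x hx
  have hx' : (0 : ℝ) < x := hx
  rw [Real.norm_eq_abs, abs_inv, abs_of_pos (by positivity)]
  exact inv_le_one_of_one_le₀ (by linarith)

theorem integrableOn_mul_abs_potential
    (hV : IntegrableOn (fun x : ℝ => (1 + x) * V x) (Ioi 0) volume) :
    IntegrableOn (fun x => x * |V x|) (Ioi 0) volume := by
  have h1 := (hV.sub (integrableOn_potential hV)).abs
  refine h1.congr ?_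
  filter_upwards [ae_restrict_mem measurableSet_Ioi] with x hx
  have hx' : (0 : ℝ) < x := hx
  simp only [Pi.sub_apply]
  rw [show (1 + x) * V x - V x = x * V x by ring, abs_mul, abs_of_pos hx']

end Potential

/-- The tail integral `x ↦ ∫_x^∞ k`. -/
def tail (k : ℝ → ℝ) (x : ℝ) : ℝ := ∫ t in Ioi x, k t

section Tail

variable {k : ℝ → ℝ}

theorem isPrim_integral_Ioi {𝕜 : Type*} [RCLike 𝕜] {k : ℝ → 𝕜}
    (hk : IntegrableOn k (Ioi 0) volume) :
    IsPrim (fun x => ∫ t in Ioi x, k t) (fun x => -k x) := by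
  refine ⟨fun x hx => ?_, fun x hx => ?_⟩
  · exact ((intervalIntegrable_iff_integrableOn_Ioc_of_le hx).2
      (hk.mono_set Ioc_subset_Ioi_self)).neg
  · have := intervalIntegral.integral_Ioi_sub_Ioi hk hx
    rw [intervalIntegral.integral_neg]
    rw [← this]
    ring

theorem isPrim_tail (hk : IntegrableOn k (Ioi 0) volume) : IsPrim (tail k) (fun x => -k x) :=
  isPrim_integral_Ioi hk

theorem tail_nonneg (hk0 : ∀ x, 0 < x → 0 ≤ k x) {x : ℝ} (hx : 0 ≤ x) : 0 ≤ tail k x :=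
  setIntegral_nonneg measurableSet_Ioi fun t ht => hk0 t (hx.trans_lt ht)

theorem tail_antitoneOn (hk : IntegrableOn k (Ioi 0) volume) (hk0 : ∀ x, 0 < x → 0 ≤ k x) :
    AntitoneOn (tail k) (Ici 0) := by
  intro x hx y hy hxy
  refine setIntegral_mono_set (hk.mono_set (Ioi_subset_Ioi hx)) ?_
    (Ioi_subset_Ioi hxy).eventuallyLE
  filter_upwards [ae_restrict_mem measurableSet_Ioi] with t ht
  exact hk0 t ((mem_Ici.1 hx).trans_lt ht)

theorem tendsto_tail (hk : IntegrableOn k (Ioi 0) volume) : Tendsto (tail k) atTop (𝓝 0) := by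
  have h1 := intervalIntegral_tendsto_integral_Ioi 0 hk tendsto_id
  have h2 : Tendsto (fun x => tail k 0 - ∫ t in (0 : ℝ)..x, k t) atTop (𝓝 (tail k 0 - tail k 0)) :=
    h1.const_sub _
  rw [sub_self] at h2
  refine h2.congr' ?_
  filter_upwards [eventually_ge_atTop 0] with x hx
  rw [(isPrim_tail hk).eq_integral x hx, intervalIntegral.integral_neg]
  ring

theorem integrableOn_mul_tail_pow (hk : IntegrableOn k (Ioi 0) volume)
    (hk0 : ∀ x, 0 < x → 0 ≤ k x) (n : ℕ) :
    IntegrableOn (fun t => k t * tail k t ^ n) (Ioi 0) volume := by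
  refine Integrable.mul_bdd (c := tail k 0 ^ n) hk ?_ ?_
  · exact (((isPrim_tail hk).continuousOn.mono Ioi_subset_Ici_self).pow n).aestronglyMeasurable
      measurableSet_Ioi
  · filter_upwards [ae_restrict_mem measurableSet_Ioi] with t ht
    have ht' : (0 : ℝ) < t := ht
    rw [Real.norm_eq_abs, abs_of_nonneg (pow_nonneg (tail_nonneg hk0 ht'.le) n)]
    exact pow_le_pow_left₀ (tail_nonneg hk0 ht'.le)
      (tail_antitoneOn hk hk0 self_mem_Ici ht'.le ht'.le) n

theorem integral_mul_tail_pow (hk : IntegrableOn k (Ioi 0) volume)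
    (hk0 : ∀ x, 0 < x → 0 ≤ k x) (n : ℕ) {x : ℝ} (hx : 0 ≤ x) :
    ∫ t in Ioi x, k t * tail k t ^ n = tail k x ^ (n + 1) / (n + 1) := by
  have hp := (isPrim_tail hk).pow n
  have h1 := intervalIntegral_tendsto_integral_Ioi x
    ((integrableOn_mul_tail_pow hk hk0 n).mono_set (Ioi_subset_Ioi hx)) tendsto_id
  have h2 : Tendsto (fun y => (tail k x ^ (n + 1) - tail k y ^ (n + 1)) / (n + 1)) atTop
      (𝓝 ((tail k x ^ (n + 1) - 0 ^ (n + 1)) / (n + 1))) :=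
    (((tendsto_tail hk).pow (n + 1)).const_sub _).div_const _
  rw [zero_pow (by simp), sub_zero] at h2
  refine tendsto_nhds_unique h1 (h2.congr' ?_)
  filter_upwards [eventually_ge_atTop 0] with y hy
  have h3 := hp.sub_eq_integral hx hy
  have h4 : ∫ t in x..y, ((n : ℝ) + 1) * (tail k t ^ n * -k t) =
      -((n + 1) * ∫ t in x..y, k t * tail k t ^ n) := by
    rw [← intervalIntegral.integral_const_mul, ← intervalIntegral.integral_neg]
    congr 1; ext t; ring
  rw [h4] at h3
  have : (n : ℝ) + 1 ≠ 0 := by positivity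
  simp only [id]
  field_simp
  linarith

end Tail

/-- The kernel `D(s, ζ) = ∫₀ˢ e^{2iζr} dr = (e^{2iζs} - 1) / (2iζ)`. -/
def jostKernel (s : ℝ) (ζ : ℂ) : ℂ := ∫ r in (0 : ℝ)..s, Complex.exp (2 * Complex.I * ζ * r)

section Kernel

theorem continuous_jostKernel : Continuous fun p : ℝ × ℂ => jostKernel p.1 p.2 := by
  have h := intervalIntegral.continuous_parametric_intervalIntegral_of_continuous
    (μ := volume) (X := ℝ × ℂ)
    (f := fun (p : ℝ × ℂ) (r : ℝ) => Complex.exp (2 * Complex.I * p.2 * r)) (a₀ := 0)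
    (by fun_prop) (s := fun p => p.1) continuous_fst
  exact h

theorem hasDerivAt_jostKernel (ζ : ℂ) (s : ℝ) :
    HasDerivAt (fun s => jostKernel s ζ) (Complex.exp (2 * Complex.I * ζ * s)) s :=
  intervalIntegral.integral_hasDerivAt_right (Continuous.intervalIntegrable (by fun_prop) _ _)
    (Continuous.stronglyMeasurableAtFilter (by fun_prop) _ _) (by fun_prop)

theorem norm_exp_I_mul_le {ζ : ℂ} (hζ : 0 ≤ ζ.im) {r : ℝ} (hr : 0 ≤ r) :
    ‖Complex.exp (Complex.I * ζ * r)‖ ≤ 1 := by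
  rw [Complex.norm_exp]
  simp
  positivity

theorem norm_exp_two_I_mul_le {ζ : ℂ} (hζ : 0 ≤ ζ.im) {r : ℝ} (hr : 0 ≤ r) :
    ‖Complex.exp (2 * Complex.I * ζ * r)‖ ≤ 1 := by
  rw [Complex.norm_exp]
  simp
  positivity

theorem norm_jostKernel_le {ζ : ℂ} (hζ : 0 ≤ ζ.im) {s : ℝ} (hs : 0 ≤ s) :
    ‖jostKernel s ζ‖ ≤ s := by
  have := intervalIntegral.norm_integral_le_of_norm_le_const (a := 0) (b := s) (C := 1)
    (f := fun r : ℝ => Complex.exp (2 * Complex.I * ζ * r)) (fun r hr => by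
      rw [uIoc_of_le hs] at hr
      exact norm_exp_two_I_mul_le hζ hr.1.le)
  simpa [jostKernel, abs_of_nonneg hs] using this

theorem mul_jostKernel (s : ℝ) (ζ : ℂ) :
    2 * Complex.I * ζ * jostKernel s ζ = Complex.exp (2 * Complex.I * ζ * s) - 1 := by
  rw [jostKernel, ← intervalIntegral.integral_const_mul]
  rw [intervalIntegral.integral_eq_sub_of_hasDerivAt
    (f := fun r : ℝ => Complex.exp (2 * Complex.I * ζ * r))]
  · simp
  · intro r _
    have h := ((Complex.ofRealCLM.hasDerivAt (x := r)).const_mul (2 * Complex.I * ζ)).cexp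
    simpa [mul_comm] using h
  · exact Continuous.intervalIntegrable (by fun_prop) _ _

theorem norm_jostKernel_le_inv {ζ : ℂ} (hζ : 0 ≤ ζ.im) (h0 : ζ ≠ 0) {s : ℝ} (hs : 0 ≤ s) :
    ‖jostKernel s ζ‖ ≤ ‖ζ‖⁻¹ := by
  have h1 := congrArg norm (mul_jostKernel s ζ)
  have h2 : ‖Complex.exp (2 * Complex.I * ζ * s) - 1‖ ≤ 2 := by
    refine (norm_sub_le _ _).trans ?_
    rw [norm_one]
    linarith [norm_exp_two_I_mul_le hζ hs]
  rw [← h1] at h2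
  simp only [norm_mul, Complex.norm_I, mul_one, Complex.norm_ofNat] at h2
  have h3 : 0 < ‖ζ‖ := norm_pos_iff.2 h0
  rw [← one_div, le_div_iff₀ h3]
  linarith

end Kernel

/-! ### The Volterra equation for the amplitude -/

/-- The closed upper half-plane. -/
abbrev ClosedUpper : Type := {ζ : ℂ // 0 ≤ ζ.im}

/-- The Volterra operator of the Jost problem: after the substitution `θ(x) = e^{iζx} m(x)` the
Jost solution is characterized by `m = 1 + T m` on `[0, ∞)`, where `T` is this operator. The positive
part in the kernel restricts the integration to `t > x`. -/
def volterra (V : ℝ → ℝ) (ζ : ℂ) (m : ℝ → ℂ) (x : ℝ) : ℂ :=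
  ∫ t in Ioi (0 : ℝ), jostKernel (max (t - x) 0) ζ * (V t * m t)

/-- The terms `Tⁿ 1` of the Neumann series for `m = 1 + T m`. -/
def volterraIter (V : ℝ → ℝ) (ζ : ℂ) : ℕ → ℝ → ℂ
  | 0 => fun _ => 1
  | n + 1 => volterra V ζ (volterraIter V ζ n)

/-- The sum of the Neumann series for `m = 1 + T m`. -/
def volterraSum (V : ℝ → ℝ) (ζ : ℂ) (x : ℝ) : ℂ := ∑' n, volterraIter V ζ n x

/-- The first moment tail `∫_x^∞ t |V(t)| dt`. -/
def momentTail (V : ℝ → ℝ) : ℝ → ℝ := tail fun t => t * |V t|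

section Series

variable {V : ℝ → ℝ} (hV : IntegrableOn (fun x : ℝ => (1 + x) * V x) (Ioi 0) volume)
include hV

theorem aestronglyMeasurable_potential :
    AEStronglyMeasurable (fun t => (V t : ℂ)) (volume.restrict (Ioi 0)) :=
  (integrableOn_potential hV).ofReal.aestronglyMeasurable

omit hV in
theorem momentTail_nonneg {x : ℝ} (hx : 0 ≤ x) : 0 ≤ momentTail V x :=
  tail_nonneg (fun _ ht => mul_nonneg ht.le (abs_nonneg _)) hx

theorem momentTail_le {x : ℝ} (hx : 0 ≤ x) : momentTail V x ≤ momentTail V 0 :=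
  tail_antitoneOn (integrableOn_mul_abs_potential hV)
    (fun _ ht => mul_nonneg ht.le (abs_nonneg _)) self_mem_Ici hx hx

/-- Continuity of the Volterra operator, jointly in the position and a parameter. -/
theorem continuous_volterra {m : ℝ × ClosedUpper → ℂ} {C : ℝ}
    (hm : ContinuousOn m (Ici 0 ×ˢ univ)) (hC : ∀ t : ℝ, 0 ≤ t → ∀ ζ, ‖m (t, ζ)‖ ≤ C) :
    Continuous fun p : ℝ × ClosedUpper => volterra V p.2 (fun t => m (t, p.2)) p.1 := by
  have hC0 : 0 ≤ C := (norm_nonneg _).trans (hC 0 le_rfl ⟨0, by simp⟩)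
  rw [continuous_iff_continuousAt]
  intro p₀
  refine continuousAt_of_dominated (bound := fun t => (t * |V t| + (|p₀.1| + 1) * |V t|) * C)
    ?_ ?_ ?_ ?_
  · refine Eventually.of_forall fun p => ?_
    refine AEStronglyMeasurable.mul ?_ ((aestronglyMeasurable_potential hV).mul ?_)
    · have : Continuous fun t : ℝ => jostKernel (max (t - p.1) 0) p.2 :=
        continuous_jostKernel.comp (f := fun t : ℝ => (max (t - p.1) 0, (p.2 : ℂ))) (by fun_prop)
      exact this.aestronglyMeasurable
    · refine ContinuousOn.aestronglyMeasurable ?_ measurableSet_Ioi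
      exact hm.comp (f := fun t : ℝ => (t, p.2)) (by fun_prop)
        (fun t ht => ⟨(mem_Ioi.1 ht).le, mem_univ _⟩)
  · have : ∀ᶠ p : ℝ × ClosedUpper in 𝓝 p₀, p.1 ∈ Ioi (p₀.1 - 1) :=
      continuous_fst.continuousAt (Ioi_mem_nhds (by linarith))
    filter_upwards [this] with p hp
    filter_upwards [ae_restrict_mem measurableSet_Ioi] with t ht
    have ht' : (0 : ℝ) < t := ht
    have hp' : p₀.1 - 1 < p.1 := hp
    rw [norm_mul, norm_mul, ← mul_assoc, Complex.norm_real, Real.norm_eq_abs, ← add_mul]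
    refine mul_le_mul (mul_le_mul_of_nonneg_right ?_ (abs_nonneg _)) (hC t ht'.le _)
      (norm_nonneg _) (by positivity)
    refine (norm_jostKernel_le p.2.2 (le_max_right _ _)).trans (max_le ?_ (by positivity))
    linarith [neg_abs_le p₀.1]
  · exact ((integrableOn_mul_abs_potential hV).add
      ((integrableOn_potential hV).abs.const_mul _)).mul_const _
  · filter_upwards [ae_restrict_mem measurableSet_Ioi] with t ht
    have ht' : (0 : ℝ) < t := ht
    refine ContinuousAt.mul ?_ (continuousAt_const.mul ?_)
    · exact (continuous_jostKernel.comp (f := fun p : ℝ × ClosedUpper =>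
        (max (t - p.1) 0, (p.2 : ℂ))) (by fun_prop)).continuousAt
    · have : Continuous fun p : ℝ × ClosedUpper => m (t, p.2) := by
        rw [← continuousOn_univ]
        exact hm.comp (f := fun p : ℝ × ClosedUpper => (t, p.2)) (by fun_prop)
          (fun p _ => ⟨ht'.le, mem_univ _⟩)
      exact this.continuousAt

/-- The Volterra bound `|Tⁿ1(x)| ≤ K(x)ⁿ / n!`, with `K` the first moment tail. The kernel is at most
`t - x ≤ t`, whatever `ζ` in the closed upper half-plane. -/
theorem volterraIter_bound {ζ : ℂ} (hζ : 0 ≤ ζ.im) (n : ℕ) :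
    ∀ x : ℝ, 0 ≤ x → ‖volterraIter V ζ n x‖ ≤ momentTail V x ^ n / n.factorial := by
  have hk := integrableOn_mul_abs_potential hV
  have hk0 : ∀ x, 0 < x → 0 ≤ x * |V x| := fun _ ht => mul_nonneg ht.le (abs_nonneg _)
  induction n with
  | zero => intro x hx; simp [volterraIter]
  | succ n ih =>
    intro x hx
    have h1 : ‖volterraIter V ζ (n + 1) x‖ ≤
        ∫ t in Ioi (0 : ℝ), (Ioi x).indicator
          (fun t => (t * |V t| * momentTail V t ^ n) / n.factorial) t := by
      refine norm_integral_le_of_norm_le ?_ ?_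
      · exact (((integrableOn_mul_tail_pow hk hk0 n).div_const _).indicator measurableSet_Ioi)
      · filter_upwards [ae_restrict_mem measurableSet_Ioi] with t ht
        have ht' : (0 : ℝ) < t := ht
        by_cases hxt : x < t
        · rw [indicator_of_mem (mem_Ioi.2 hxt), norm_mul, norm_mul, ← mul_assoc, Complex.norm_real,
            Real.norm_eq_abs, mul_div_assoc]
          refine mul_le_mul (mul_le_mul_of_nonneg_right ?_ (abs_nonneg _)) (ih t ht'.le)
            (norm_nonneg _) (by positivity)
          refine (norm_jostKernel_le hζ (le_max_right _ _)).trans (max_le ?_ ht'.le)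
          linarith
        · rw [indicator_of_notMem (by simpa using hxt), max_eq_right (by linarith)]
          simp [jostKernel]
    refine h1.trans_eq ?_
    rw [setIntegral_indicator measurableSet_Ioi,
      inter_eq_self_of_subset_right (Ioi_subset_Ioi hx), integral_div]
    have h2 := integral_mul_tail_pow hk hk0 n hx
    rw [show (∫ t in Ioi x, t * |V t| * momentTail V t ^ n) = _ from h2, Nat.factorial_succ]
    push_cast
    rw [div_div, mul_comm ((n : ℝ) + 1)]
    rfl

theorem volterraIter_bound' {ζ : ℂ} (hζ : 0 ≤ ζ.im) (n : ℕ) {x : ℝ} (hx : 0 ≤ x) :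
    ‖volterraIter V ζ n x‖ ≤ momentTail V 0 ^ n / n.factorial := by
  refine (volterraIter_bound hV hζ n x hx).trans ?_
  gcongr
  · exact momentTail_nonneg hx
  · exact momentTail_le hV hx

theorem continuousOn_volterraIter (n : ℕ) :
    ContinuousOn (fun p : ℝ × ClosedUpper => volterraIter V p.2 n p.1) (Ici 0 ×ˢ univ) := by
  induction n with
  | zero => exact continuousOn_const
  | succ n ih =>
    exact (continuous_volterra hV ih
      (fun t ht ζ => volterraIter_bound' hV ζ.2 n ht)).continuousOn

theorem summable_volterraIter {ζ : ℂ} (hζ : 0 ≤ ζ.im) {x : ℝ} (hx : 0 ≤ x) :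
    Summable fun n => volterraIter V ζ n x :=
  Summable.of_norm_bounded (Real.summable_pow_div_factorial (momentTail V 0))
    fun n => volterraIter_bound' hV hζ n hx

theorem continuousOn_volterraSum :
    ContinuousOn (fun p : ℝ × ClosedUpper => volterraSum V p.2 p.1) (Ici 0 ×ˢ univ) :=
  continuousOn_tsum (continuousOn_volterraIter hV)
    (Real.summable_pow_div_factorial (momentTail V 0))
    fun n p hp => volterraIter_bound' hV p.2.2 n hp.1

theorem norm_volterraSum_le {ζ : ℂ} (hζ : 0 ≤ ζ.im) {x : ℝ} (hx : 0 ≤ x) :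
    ‖volterraSum V ζ x‖ ≤ Real.exp (momentTail V 0) := by
  have h := Real.summable_pow_div_factorial (momentTail V 0)
  refine (tsum_of_norm_bounded h.hasSum fun n => volterraIter_bound' hV hζ n hx).trans_eq ?_
  rw [Real.exp_eq_exp_ℝ, NormedSpace.exp_eq_tsum_div]

theorem integrableOn_potential_mul {m : ℝ → ℂ} {C : ℝ} (hm : ContinuousOn m (Ici 0))
    (hC : ∀ t : ℝ, 0 ≤ t → ‖m t‖ ≤ C) :
    IntegrableOn (fun t => (V t : ℂ) * m t) (Ioi 0) volume := by
  refine Integrable.mul_bdd (c := C) (integrableOn_potential hV).ofReal ?_ ?_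
  · exact (hm.mono Ioi_subset_Ici_self).aestronglyMeasurable measurableSet_Ioi
  · filter_upwards [ae_restrict_mem measurableSet_Ioi] with t ht
    exact hC t (mem_Ioi.1 ht).le

theorem integrableOn_volterra {ζ : ℂ} (hζ : 0 ≤ ζ.im) {m : ℝ → ℂ} {C : ℝ}
    (hm : ContinuousOn m (Ici 0)) (hC : ∀ t : ℝ, 0 ≤ t → ‖m t‖ ≤ C) (x : ℝ) :
    IntegrableOn (fun t => jostKernel (max (t - x) 0) ζ * (V t * m t)) (Ioi 0) volume := by
  have hC0 : 0 ≤ C := (norm_nonneg _).trans (hC 0 le_rfl)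
  refine Integrable.mono' (g := fun t => (t * |V t| + |x| * |V t|) * C)
    (((integrableOn_mul_abs_potential hV).add
      ((integrableOn_potential hV).abs.const_mul _)).mul_const _) ?_ ?_
  · refine AEStronglyMeasurable.mul ?_ (integrableOn_potential_mul hV hm hC).aestronglyMeasurable
    exact (continuous_jostKernel.comp (f := fun t : ℝ => (max (t - x) 0, ζ))
      (by fun_prop)).aestronglyMeasurable
  · filter_upwards [ae_restrict_mem measurableSet_Ioi] with t ht
    have ht' : (0 : ℝ) < t := ht
    rw [norm_mul, norm_mul, ← mul_assoc, Complex.norm_real, Real.norm_eq_abs, ← add_mul]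
    refine mul_le_mul (mul_le_mul_of_nonneg_right ?_ (abs_nonneg _)) (hC t ht'.le)
      (norm_nonneg _) (by positivity)
    refine (norm_jostKernel_le hζ (le_max_right _ _)).trans (max_le ?_ (by positivity))
    linarith [neg_abs_le x]

theorem volterraSum_eq {ζ : ℂ} (hζ : 0 ≤ ζ.im) {x : ℝ} (hx : 0 ≤ x) :
    volterraSum V ζ x = 1 + volterra V ζ (volterraSum V ζ) x := by
  have h0 := (summable_volterraIter hV hζ hx).tsum_eq_zero_add
  rw [volterraSum, h0]
  congr 1
  have hc : ∀ n, ContinuousOn (volterraIter V ζ n) (Ici 0) := fun n =>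
    (continuousOn_volterraIter hV n).comp (f := fun x : ℝ => (x, (⟨ζ, hζ⟩ : ClosedUpper)))
      (by fun_prop) (fun _ ht => ⟨ht, mem_univ _⟩)
  have hb := fun n t (ht : (0 : ℝ) ≤ t) => volterraIter_bound' hV hζ n ht
  have key := hasSum_integral_of_summable_integral_norm
    (μ := volume.restrict (Ioi (0 : ℝ)))
    (F := fun n t => jostKernel (max (t - x) 0) ζ * (V t * volterraIter V ζ n t))
    (fun n => integrableOn_volterra hV hζ (hc n) (hb n) x) ?_
  · have h1 := key.tsum_eq
    rw [show (∑' b, volterraIter V ζ (b + 1) x) =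
      ∑' b, ∫ t in Ioi (0 : ℝ), jostKernel (max (t - x) 0) ζ * (V t * volterraIter V ζ b t)
      from rfl, h1]
    refine setIntegral_congr_fun measurableSet_Ioi fun t ht => ?_
    simp only [tsum_mul_left, volterraSum]
  · have hi := (integrableOn_mul_abs_potential hV)
    refine Summable.of_norm_bounded (g := fun n => (∫ t in Ioi (0 : ℝ), t * |V t|) *
      (momentTail V 0 ^ n / n.factorial))
      ((Real.summable_pow_div_factorial (momentTail V 0)).mul_left _) fun n => ?_
    rw [← integral_mul_const, Real.norm_eq_abs, abs_of_nonneg (integral_nonneg fun _ => norm_nonneg _)]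
    refine integral_mono_of_nonneg (Eventually.of_forall fun _ => norm_nonneg _)
      (hi.mul_const _) ?_
    filter_upwards [ae_restrict_mem measurableSet_Ioi] with t ht
    have ht' : (0 : ℝ) < t := ht
    rw [norm_mul, norm_mul, ← mul_assoc, Complex.norm_real, Real.norm_eq_abs]
    refine mul_le_mul (mul_le_mul_of_nonneg_right ?_ (abs_nonneg _)) (hb n t ht'.le)
      (norm_nonneg _) (by positivity)
    refine (norm_jostKernel_le hζ (le_max_right _ _)).trans (max_le ?_ (by positivity))
    linarith

end Series

/-! ### Existence of the Jost solution -/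

/-- The amplitude `m(x, ζ) = e^{-iζx} θ(x, ζ)` of the Jost solution, the solution of `m = 1 + T m`. -/
def jostAmp (V : ℝ → ℝ) (ζ : ℂ) (x : ℝ) : ℂ := 1 + volterra V ζ (volterraSum V ζ) x

/-- The derivative of the amplitude `m(x, ζ)` for `x ≥ 0`. -/
def jostAmpDeriv (V : ℝ → ℝ) (ζ : ℂ) (x : ℝ) : ℂ :=
  -∫ t in Ioi x, Complex.exp (2 * Complex.I * ζ * (t - x : ℝ)) * (V t * jostAmp V ζ t)

section Amplitude

variable {V : ℝ → ℝ}

theorem norm_jostKernel_sub_le {ζ : ℂ} (hζ : 0 ≤ ζ.im) {s s' : ℝ} (hs : 0 ≤ s) (hs' : 0 ≤ s') :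
    ‖jostKernel s ζ - jostKernel s' ζ‖ ≤ |s - s'| := by
  rw [jostKernel, jostKernel, intervalIntegral.integral_interval_sub_left
    (Continuous.intervalIntegrable (by fun_prop) _ _)
    (Continuous.intervalIntegrable (by fun_prop) _ _)]
  have := intervalIntegral.norm_integral_le_of_norm_le_const (a := s') (b := s) (C := 1)
    (f := fun r : ℝ => Complex.exp (2 * Complex.I * ζ * r)) (fun r hr => by
      refine norm_exp_two_I_mul_le hζ ?_
      have := (le_min hs' hs).trans_lt hr.1
      exact this.le)
  simpa using this

variable (hV : IntegrableOn (fun x : ℝ => (1 + x) * V x) (Ioi 0) volume)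
include hV

theorem jostAmp_eq_volterraSum {ζ : ℂ} (hζ : 0 ≤ ζ.im) {x : ℝ} (hx : 0 ≤ x) :
    jostAmp V ζ x = volterraSum V ζ x := (volterraSum_eq hV hζ hx).symm

theorem continuous_jostAmp :
    Continuous fun p : ℝ × ClosedUpper => jostAmp V p.2 p.1 :=
  continuous_const.add (continuous_volterra hV (continuousOn_volterraSum hV)
    fun _ ht ζ => norm_volterraSum_le hV ζ.2 ht)

theorem continuous_jostAmp_left {ζ : ℂ} (hζ : 0 ≤ ζ.im) : Continuous (jostAmp V ζ) :=
  (continuous_jostAmp hV).comp (f := fun x : ℝ => (x, (⟨ζ, hζ⟩ : ClosedUpper))) (by fun_prop)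

theorem norm_jostAmp_le {ζ : ℂ} (hζ : 0 ≤ ζ.im) {x : ℝ} (hx : 0 ≤ x) :
    ‖jostAmp V ζ x‖ ≤ Real.exp (momentTail V 0) := by
  rw [jostAmp_eq_volterraSum hV hζ hx]
  exact norm_volterraSum_le hV hζ hx

theorem jostAmp_sub_one {ζ : ℂ} (hζ : 0 ≤ ζ.im) (x : ℝ) :
    jostAmp V ζ x - 1 = volterra V ζ (jostAmp V ζ) x := by
  rw [jostAmp, add_sub_cancel_left]
  refine setIntegral_congr_fun measurableSet_Ioi fun t ht => ?_
  simp only [jostAmp_eq_volterraSum hV hζ (mem_Ioi.1 ht).le]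

theorem integrableOn_potential_mul_jostAmp {ζ : ℂ} (hζ : 0 ≤ ζ.im) :
    IntegrableOn (fun t => (V t : ℂ) * jostAmp V ζ t) (Ioi 0) volume :=
  integrableOn_potential_mul hV (continuous_jostAmp_left hV hζ).continuousOn
    fun _ ht => norm_jostAmp_le hV hζ ht

/-- The amplitude tends to `1` at infinity, uniformly in the closed upper half-plane. -/
theorem norm_jostAmp_sub_one_le {ζ : ℂ} (hζ : 0 ≤ ζ.im) {x : ℝ} (hx : 0 ≤ x) :
    ‖jostAmp V ζ x - 1‖ ≤ Real.exp (momentTail V 0) * momentTail V x := by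
  rw [jostAmp_sub_one hV hζ]
  have h1 : ‖volterra V ζ (jostAmp V ζ) x‖ ≤
      ∫ t in Ioi (0 : ℝ), (Ioi x).indicator
        (fun t => Real.exp (momentTail V 0) * (t * |V t|)) t := by
    refine norm_integral_le_of_norm_le
      (((integrableOn_mul_abs_potential hV).const_mul _).indicator measurableSet_Ioi) ?_
    filter_upwards [ae_restrict_mem measurableSet_Ioi] with t ht
    have ht' : (0 : ℝ) < t := ht
    by_cases hxt : x < t
    · rw [indicator_of_mem (mem_Ioi.2 hxt), norm_mul, norm_mul, ← mul_assoc, Complex.norm_real,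
        Real.norm_eq_abs, mul_comm (Real.exp _)]
      refine mul_le_mul (mul_le_mul_of_nonneg_right ?_ (abs_nonneg _))
        (norm_jostAmp_le hV hζ ht'.le) (norm_nonneg _) (by positivity)
      refine (norm_jostKernel_le hζ (le_max_right _ _)).trans (max_le ?_ ht'.le)
      linarith
    · rw [indicator_of_notMem (by simpa using hxt), max_eq_right (by linarith)]
      simp [jostKernel]
  refine h1.trans_eq ?_
  rw [setIntegral_indicator measurableSet_Ioi,
    inter_eq_self_of_subset_right (Ioi_subset_Ioi hx), integral_const_mul]
  rfl

/-- The amplitude tends to `1` as `|ζ| → ∞`, because the kernel is also bounded by `1 / |ζ|`. -/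
theorem norm_jostAmp_sub_one_le_div {ζ : ℂ} (hζ : 0 ≤ ζ.im) (h0 : ζ ≠ 0) (x : ℝ) :
    ‖jostAmp V ζ x - 1‖ ≤ Real.exp (momentTail V 0) * tail (fun t => |V t|) 0 / ‖ζ‖ := by
  rw [jostAmp_sub_one hV hζ]
  have h1 : ‖volterra V ζ (jostAmp V ζ) x‖ ≤
      ∫ t in Ioi (0 : ℝ), (Real.exp (momentTail V 0) / ‖ζ‖) * |V t| := by
    refine norm_integral_le_of_norm_le ((integrableOn_potential hV).abs.const_mul _) ?_
    filter_upwards [ae_restrict_mem measurableSet_Ioi] with t ht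
    have ht' : (0 : ℝ) < t := ht
    rw [norm_mul, norm_mul, Complex.norm_real, Real.norm_eq_abs,
      show Real.exp (momentTail V 0) / ‖ζ‖ * |V t| =
        ‖ζ‖⁻¹ * (|V t| * Real.exp (momentTail V 0)) by ring]
    refine mul_le_mul (norm_jostKernel_le_inv hζ h0 (le_max_right _ _))
      (mul_le_mul_of_nonneg_left (norm_jostAmp_le hV hζ ht'.le) (abs_nonneg _))
      (by positivity) (by positivity)
  refine h1.trans_eq ?_
  rw [integral_const_mul, tail]
  ring

theorem norm_jostAmpDeriv_le {ζ : ℂ} (hζ : 0 ≤ ζ.im) {x : ℝ} (hx : 0 ≤ x) :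
    ‖jostAmpDeriv V ζ x‖ ≤ Real.exp (momentTail V 0) * tail (fun t => |V t|) x := by
  rw [jostAmpDeriv, norm_neg, tail, ← integral_const_mul]
  refine norm_integral_le_of_norm_le
    ((IntegrableOn.mono_set (integrableOn_potential hV).abs (Ioi_subset_Ioi hx)).const_mul _) ?_
  filter_upwards [ae_restrict_mem measurableSet_Ioi] with t ht
  have ht' : x < t := ht
  rw [norm_mul, norm_mul, Complex.norm_real, Real.norm_eq_abs]
  calc _ ≤ 1 * (|V t| * Real.exp (momentTail V 0)) := by
        refine mul_le_mul (norm_exp_two_I_mul_le hζ (by linarith))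
          (mul_le_mul_of_nonneg_left (norm_jostAmp_le hV hζ (by linarith)) (abs_nonneg _))
          (by positivity) zero_le_one
    _ = _ := by ring

theorem integrableOn_exp_mul_potential_mul_jostAmp {ζ : ℂ} (hζ : 0 ≤ ζ.im) :
    IntegrableOn (fun t : ℝ => Complex.exp (2 * Complex.I * ζ * t) * (V t * jostAmp V ζ t))
      (Ioi 0) volume := by
  refine (integrableOn_potential_mul_jostAmp hV hζ).bdd_mul (c := 1)
    (Continuous.aestronglyMeasurable (by fun_prop)) ?_
  filter_upwards [ae_restrict_mem measurableSet_Ioi] with t ht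
  exact norm_exp_two_I_mul_le hζ (mem_Ioi.1 ht).le

omit hV in
theorem jostAmpDeriv_eq (ζ : ℂ) (x : ℝ) : jostAmpDeriv V ζ x =
    -(Complex.exp (-(2 * Complex.I * ζ * x)) *
      ∫ t in Ioi x, Complex.exp (2 * Complex.I * ζ * t) * (V t * jostAmp V ζ t)) := by
  rw [jostAmpDeriv, ← integral_const_mul]
  refine congrArg _ (integral_congr_ae (Eventually.of_forall fun t => ?_))
  have : Complex.exp (2 * Complex.I * ζ * (t - x : ℝ)) =
      Complex.exp (-(2 * Complex.I * ζ * x)) * Complex.exp (2 * Complex.I * ζ * t) := by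
    rw [← Complex.exp_add]; congr 1; push_cast; ring
  beta_reduce
  rw [this, mul_assoc]

/-- Differentiation under the integral sign. The kernel is Lipschitz in `x`, and differentiable in
`x` except at `x = t`. -/
theorem hasDerivAt_jostAmp {ζ : ℂ} (hζ : 0 ≤ ζ.im) {x : ℝ} (hx : 0 ≤ x) :
    HasDerivAt (jostAmp V ζ) (jostAmpDeriv V ζ x) x := by
  have hV' := integrableOn_potential_mul_jostAmp hV hζ
  have hD := hasDerivAt_integral_of_dominated_loc_of_lip
    (μ := volume.restrict (Ioi (0 : ℝ))) (x₀ := x) (s := univ)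
    (F := fun y t => jostKernel (max (t - y) 0) ζ * (V t * jostAmp V ζ t))
    (F' := fun t => (Ioi x).indicator
      (fun t : ℝ => -(Complex.exp (2 * Complex.I * ζ * (t - x : ℝ)) * (V t * jostAmp V ζ t))) t)
    (bound := fun t => ‖(V t : ℂ) * jostAmp V ζ t‖) univ_mem
    (Eventually.of_forall fun y => (integrableOn_volterra hV hζ
      (continuous_jostAmp_left hV hζ).continuousOn
      (fun t ht => norm_jostAmp_le hV hζ ht) y).aestronglyMeasurable)
    (integrableOn_volterra hV hζ (continuous_jostAmp_left hV hζ).continuousOn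
      (fun t ht => norm_jostAmp_le hV hζ ht) x)
    (AEStronglyMeasurable.indicator
      (((Continuous.aestronglyMeasurable (by fun_prop)).mul hV'.aestronglyMeasurable).neg)
      measurableSet_Ioi)
    ?_ hV'.norm ?_
  · have h2 : jostAmp V ζ = fun y => 1 + volterra V ζ (jostAmp V ζ) y := by
      ext y; rw [← jostAmp_sub_one hV hζ]; ring
    rw [h2]
    refine (hD.2.const_add 1).congr_deriv ?_
    rw [setIntegral_indicator measurableSet_Ioi,
      inter_eq_self_of_subset_right (Ioi_subset_Ioi hx), integral_neg]
    rfl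
  · refine Eventually.of_forall fun t => ?_
    refine LipschitzOnWith.of_dist_le_mul fun y _ z _ => ?_
    rw [dist_eq_norm, ← sub_mul, norm_mul, mul_comm, dist_eq_norm]
    simp only [Real.coe_nnabs, abs_norm]
    refine mul_le_mul_of_nonneg_left ?_ (norm_nonneg _)
    refine (norm_jostKernel_sub_le hζ (le_max_right _ _) (le_max_right _ _)).trans ?_
    refine (abs_max_sub_max_le_abs _ _ _).trans ?_
    rw [Real.norm_eq_abs, abs_sub_comm]
    ring_nf
    rfl
  · have h0 : ∀ᵐ t ∂volume.restrict (Ioi (0 : ℝ)), t ≠ x :=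
      ae_restrict_of_ae (by simp [ae_iff])
    filter_upwards [h0] with t ht
    rcases lt_or_gt_of_ne ht with h | h
    · rw [indicator_of_notMem (by simpa using h.le)]
      refine (hasDerivAt_const x (0 : ℂ)).congr_of_eventuallyEq ?_
      filter_upwards [lt_mem_nhds h] with y hy
      rw [max_eq_right (by linarith)]
      simp [jostKernel]
    · rw [indicator_of_mem (mem_Ioi.2 h)]
      have h1 : HasDerivAt (fun y => jostKernel (t - y) ζ * (V t * jostAmp V ζ t))
          (-(Complex.exp (2 * Complex.I * ζ * (t - x : ℝ)) * (V t * jostAmp V ζ t))) x := by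
        have := ((hasDerivAt_jostKernel ζ (t - x)).scomp x
          ((hasDerivAt_id x).const_sub t)).mul_const (V t * jostAmp V ζ t)
        refine this.congr_deriv ?_
        simp
      refine h1.congr_of_eventuallyEq ?_
      filter_upwards [gt_mem_nhds h] with y hy
      rw [max_eq_left (by linarith)]

theorem isPrim_jostAmp {ζ : ℂ} (hζ : 0 ≤ ζ.im) : IsPrim (jostAmp V ζ) (jostAmpDeriv V ζ) := by
  refine IsPrim.of_hasDerivWithinAt
    (fun x hx => (hasDerivAt_jostAmp hV hζ hx).hasDerivWithinAt) ?_
  have h := (isPrim_integral_Ioi (integrableOn_exp_mul_potential_mul_jostAmp hV hζ)).continuousOn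
  have h2 : jostAmpDeriv V ζ = fun x => _ := funext fun x => jostAmpDeriv_eq ζ x
  rw [h2]
  exact (ContinuousOn.mul (by fun_prop) h).neg

omit hV in
theorem hasDerivAt_cexp_mul (c : ℂ) (x : ℝ) :
    HasDerivAt (fun x : ℝ => Complex.exp (c * x)) (c * Complex.exp (c * x)) x := by
  have h := ((Complex.ofRealCLM.hasDerivAt (x := x)).const_mul c).cexp
  simpa [mul_comm] using h

omit hV in
theorem isPrim_cexp_mul (c : ℂ) :
    IsPrim (fun x : ℝ => Complex.exp (c * x)) (fun x : ℝ => c * Complex.exp (c * x)) :=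
  IsPrim.of_hasDerivWithinAt (fun x _ => (hasDerivAt_cexp_mul c x).hasDerivWithinAt)
    (Continuous.continuousOn (by fun_prop))

omit hV in
theorem tendsto_momentTail (hV : IntegrableOn (fun x : ℝ => (1 + x) * V x) (Ioi 0) volume) :
    Tendsto (momentTail V) atTop (𝓝 0) :=
  tendsto_tail (integrableOn_mul_abs_potential hV)

theorem tendsto_jostAmp {ζ : ℂ} (hζ : 0 ≤ ζ.im) : Tendsto (jostAmp V ζ) atTop (𝓝 1) := by
  rw [tendsto_iff_norm_sub_tendsto_zero]
  have h := (tendsto_momentTail hV).const_mul (Real.exp (momentTail V 0))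
  rw [mul_zero] at h
  refine squeeze_zero' (Eventually.of_forall fun _ => norm_nonneg _) ?_ h
  filter_upwards [eventually_ge_atTop 0] with x hx
  exact norm_jostAmp_sub_one_le hV hζ hx

theorem tendsto_jostAmpDeriv {ζ : ℂ} (hζ : 0 ≤ ζ.im) :
    Tendsto (jostAmpDeriv V ζ) atTop (𝓝 0) := by
  have h := (tendsto_tail (integrableOn_potential hV).abs).const_mul (Real.exp (momentTail V 0))
  rw [mul_zero] at h
  refine squeeze_zero_norm' ?_ h
  filter_upwards [eventually_ge_atTop 0] with x hx
  exact norm_jostAmpDeriv_le hV hζ hx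

/-- The Jost solution exists for every `ζ` in the closed upper half-plane. -/
theorem isJostSolution_jostAmp {ζ : ℂ} (hζ : 0 ≤ ζ.im) : IsJostSolution V ζ
    (fun x => Complex.exp (Complex.I * ζ * x) * jostAmp V ζ x)
    (fun x => Complex.exp (Complex.I * ζ * x) *
      (Complex.I * ζ * jostAmp V ζ x + jostAmpDeriv V ζ x)) := by
  have hexp : ∀ x : ℝ, Complex.exp (-(Complex.I * ζ * x)) * Complex.exp (Complex.I * ζ * x) = 1 :=
    fun x => by rw [← Complex.exp_add]; simp
  refine ⟨⟨fun x hx => ?_, ?_⟩, ?_, ?_⟩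
  · refine ((hasDerivAt_cexp_mul (Complex.I * ζ) x).mul
      (hasDerivAt_jostAmp hV hζ hx)).hasDerivWithinAt.congr_deriv ?_
    ring
  · have hp1 := ((isPrim_cexp_mul (Complex.I * ζ)).mul (isPrim_jostAmp hV hζ)).const_mul
      (Complex.I * ζ)
    have hp2 := (isPrim_cexp_mul (-(Complex.I * ζ))).mul
      (isPrim_integral_Ioi (integrableOn_exp_mul_potential_mul_jostAmp hV hζ))
    have hsplit : ∀ x : ℝ, Complex.exp (-(2 * Complex.I * ζ * x)) =
        Complex.exp (-(Complex.I * ζ * x)) * Complex.exp (-(Complex.I * ζ * x)) := fun x => by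
      rw [← Complex.exp_add]; congr 1; ring
    have hsplit' : ∀ x : ℝ, Complex.exp (2 * Complex.I * ζ * x) =
        Complex.exp (Complex.I * ζ * x) * Complex.exp (Complex.I * ζ * x) := fun x => by
      rw [← Complex.exp_add]; congr 1; ring
    refine ((hp1.sub hp2).congr (fun x _ => ?_) (Eventually.of_forall fun x _ => ?_)).eq_integral
    · rw [jostAmpDeriv_eq, hsplit, neg_mul]
      linear_combination (Complex.exp (-(Complex.I * ζ * x)) * ∫ t in Ioi x,
        Complex.exp (2 * Complex.I * ζ * t) * (V t * jostAmp V ζ t)) * hexp x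
    · have I2 := Complex.I_sq
      simp only [jostAmpDeriv_eq, neg_mul]
      generalize (∫ t in Ioi x, Complex.exp (2 * Complex.I * ζ * t) * (V t * jostAmp V ζ t)) = A
      simp only [hsplit, hsplit']
      have h := hexp x
      generalize Complex.exp (-(Complex.I * ζ * x)) = e' at *
      generalize Complex.exp (Complex.I * ζ * x) = e at *
      linear_combination ζ ^ 2 * e * jostAmp V ζ x * I2 +
        (V x * e * jostAmp V ζ x - Complex.I * ζ * e' * A) * h
  · refine (tendsto_jostAmp hV hζ).congr fun x => ?_
    rw [← mul_assoc, hexp, one_mul]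
  · have h := ((tendsto_jostAmp hV hζ).const_mul (Complex.I * ζ)).add (tendsto_jostAmpDeriv hV hζ)
    rw [mul_one, add_zero] at h
    refine h.congr fun x => ?_
    rw [← mul_assoc, hexp, one_mul]

end Amplitude

/-! ### Wronskians and uniqueness -/

/-- The Wronskian `u₁ u₂' - u₁' u₂`. -/
def wronskian (u₁ u₁' u₂ u₂' : ℝ → ℂ) (x : ℝ) : ℂ := u₁ x * u₂' x - u₁' x * u₂ x

section Solutions

variable {V : ℝ → ℝ} {ζ ζ₁ ζ₂ : ℂ} {u u' u₁ u₁' u₂ u₂' θ θ' : ℝ → ℂ}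

namespace IsSolution

theorem continuousOn (h : IsSolution V ζ u u') : ContinuousOn u (Ici 0) :=
  fun x hx => (h.hasDeriv x hx).continuousWithinAt

theorem conjugate (h : IsSolution V ζ u u') :
    IsSolution V (-conj ζ) (fun x => conj (u x)) (fun x => conj (u' x)) := by
  refine ⟨fun x hx => ?_, fun x hx => ?_⟩
  · exact (Complex.conjCLE.toContinuousLinearMap.hasFDerivAt (x := u x)).comp_hasDerivWithinAt x
      (h.hasDeriv x hx)
  · rw [h.deriv_eq x hx, map_add]
    simp only [intervalIntegral, ← integral_conj, map_sub]
    simp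

end IsSolution

variable (hV : IntegrableOn (fun x : ℝ => (1 + x) * V x) (Ioi 0) volume)
include hV

theorem intervalIntegrable_potential_sub (c : ℂ) {x : ℝ} (hx : 0 ≤ x) :
    IntervalIntegrable (fun t => (V t : ℂ) - c) volume 0 x := by
  refine IntervalIntegrable.sub ?_ (by simp)
  rw [intervalIntegrable_iff_integrableOn_Ioc_of_le hx]
  exact IntegrableOn.mono_set (integrableOn_potential hV).ofReal Ioc_subset_Ioi_self

namespace IsSolution

theorem isPrim_deriv (h : IsSolution V ζ u u') :
    IsPrim u' (fun x => ((V x : ℂ) - ζ ^ 2) * u x) :=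
  ⟨fun x hx => (intervalIntegrable_potential_sub hV _ hx).mul_continuousOn
    (h.continuousOn.mono (by rw [uIcc_of_le hx]; exact Icc_subset_Ici_self)), h.deriv_eq⟩

theorem isPrim (h : IsSolution V ζ u u') : IsPrim u u' :=
  IsPrim.of_hasDerivWithinAt h.hasDeriv (h.isPrim_deriv hV).continuousOn

/-- Green's formula for two solutions, in differential form. -/
theorem isPrim_wronskian (h₁ : IsSolution V ζ₁ u₁ u₁') (h₂ : IsSolution V ζ₂ u₂ u₂') :
    IsPrim (wronskian u₁ u₁' u₂ u₂') (fun x => (ζ₁ ^ 2 - ζ₂ ^ 2) * (u₁ x * u₂ x)) := by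
  refine (((h₁.isPrim hV).mul (h₂.isPrim_deriv hV)).sub
    ((h₁.isPrim_deriv hV).mul (h₂.isPrim hV))).congr (fun x _ => rfl)
    (Eventually.of_forall fun x _ => ?_)
  ring

theorem wronskian_eq (h₁ : IsSolution V ζ₁ u₁ u₁') (h₂ : IsSolution V ζ₂ u₂ u₂') {x : ℝ}
    (hx : 0 ≤ x) : wronskian u₁ u₁' u₂ u₂' x = wronskian u₁ u₁' u₂ u₂' 0 +
      (ζ₁ ^ 2 - ζ₂ ^ 2) * ∫ t in (0 : ℝ)..x, u₁ t * u₂ t := by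
  rw [(h₁.isPrim_wronskian hV h₂).eq_integral x hx, intervalIntegral.integral_const_mul]

theorem wronskian_const (h₁ : IsSolution V ζ₁ u₁ u₁') (h₂ : IsSolution V ζ₂ u₂ u₂')
    (hs : ζ₁ ^ 2 = ζ₂ ^ 2) {x : ℝ} (hx : 0 ≤ x) :
    wronskian u₁ u₁' u₂ u₂' x = wronskian u₁ u₁' u₂ u₂' 0 := by
  rw [h₁.wronskian_eq hV h₂ hx, hs, sub_self, zero_mul, add_zero]

theorem sub_const_mul (h₁ : IsSolution V ζ u₁ u₁') (h₂ : IsSolution V ζ u₂ u₂') (c : ℂ) :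
    IsSolution V ζ (fun x => u₁ x - c * u₂ x) (fun x => u₁' x - c * u₂' x) := by
  refine ⟨fun x hx => (h₁.hasDeriv x hx).sub ((h₂.hasDeriv x hx).const_mul c), ?_⟩
  refine (((h₁.isPrim_deriv hV).sub ((h₂.isPrim_deriv hV).const_mul c)).congr (fun x _ => rfl)
    (Eventually.of_forall fun x _ => ?_)).eq_integral
  ring

/-- A solution with vanishing Cauchy data at `0` vanishes identically. -/
theorem eq_zero (h : IsSolution V ζ u u') (h0 : u 0 = 0) (h0' : u' 0 = 0) :
    ∀ x, 0 ≤ x → u x = 0 ∧ u' x = 0 := by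
  have hp := h.isPrim hV
  have hp' := h.isPrim_deriv hV
  set q : ℝ → ℝ := fun t => 1 + ‖(V t : ℂ) - ζ ^ 2‖ with hq
  have hqi : ∀ x, 0 ≤ x → IntervalIntegrable q volume 0 x := fun x hx =>
    (by simp : IntervalIntegrable (fun _ => (1 : ℝ)) volume 0 x).add
      (intervalIntegrable_potential_sub hV _ hx).norm
  have hgc : ContinuousOn (fun x => ‖u x‖ + ‖u' x‖) (Ici 0) :=
    hp.continuousOn.norm.add hp'.continuousOn.norm
  have key := eq_zero_of_le_integral_mul (q := q) (g := fun x => ‖u x‖ + ‖u' x‖)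
    (fun x => by positivity) hqi hgc (fun x _ => by positivity) (fun x hx => by
      have h1 : ‖u x‖ ≤ ∫ t in (0 : ℝ)..x, ‖u' t‖ := by
        rw [hp.eq_integral x hx, h0, zero_add]
        exact intervalIntegral.norm_integral_le_integral_norm hx
      have h2 : ‖u' x‖ ≤ ∫ t in (0 : ℝ)..x, ‖((V t : ℂ) - ζ ^ 2) * u t‖ := by
        rw [hp'.eq_integral x hx, h0', zero_add]
        exact intervalIntegral.norm_integral_le_integral_norm hx
      refine (add_le_add h1 h2).trans ?_
      rw [← intervalIntegral.integral_add (hp.integrable x hx).norm (hp'.integrable x hx).norm]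
      refine intervalIntegral.integral_mono_on hx
        ((hp.integrable x hx).norm.add (hp'.integrable x hx).norm) ?_ fun t _ => ?_
      · exact (hqi x hx).mul_continuousOn
          (hgc.mono (by rw [uIcc_of_le hx]; exact Icc_subset_Ici_self))
      · simp only [hq, norm_mul]
        nlinarith [norm_nonneg (u t), norm_nonneg (u' t), norm_nonneg ((V t : ℂ) - ζ ^ 2),
          mul_nonneg (norm_nonneg ((V t : ℂ) - ζ ^ 2)) (norm_nonneg (u' t))])
  intro x hx
  have := key x hx
  have h1 := norm_nonneg (u x)
  have h2 := norm_nonneg (u' x)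
  exact ⟨norm_eq_zero.1 (by linarith), norm_eq_zero.1 (by linarith)⟩

/-- Solutions with vanishing Wronskian are proportional. -/
theorem exists_eq_const_mul (h : IsSolution V ζ u u') (hθ : IsSolution V ζ θ θ')
    (hW : wronskian u u' θ θ' 0 = 0) (hne : ¬(θ 0 = 0 ∧ θ' 0 = 0)) :
    ∃ c : ℂ, ∀ x, 0 ≤ x → u x = c * θ x ∧ u' x = c * θ' x := by
  obtain ⟨c, hc, hc'⟩ : ∃ c : ℂ, u 0 = c * θ 0 ∧ u' 0 = c * θ' 0 := by
    simp only [wronskian] at hW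
    by_cases h0 : θ 0 = 0
    · have h0' : θ' 0 ≠ 0 := fun h1 => hne ⟨h0, h1⟩
      refine ⟨u' 0 / θ' 0, ?_, by field_simp⟩
      have : u 0 * θ' 0 = 0 := by simpa [h0] using hW
      rw [h0, mul_zero]
      exact (mul_eq_zero.1 this).resolve_right h0'
    · refine ⟨u 0 / θ 0, by field_simp, ?_⟩
      field_simp
      linear_combination -hW
  refine ⟨c, fun x hx => ?_⟩
  have := (h.sub_const_mul hV hθ c).eq_zero hV (by rw [hc, sub_self]) (by rw [hc', sub_self]) x hx
  exact ⟨sub_eq_zero.1 this.1, sub_eq_zero.1 this.2⟩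

end IsSolution

theorem IsJostSolution.not_trivial (h : IsJostSolution V ζ θ θ') : ¬(θ 0 = 0 ∧ θ' 0 = 0) := by
  rintro ⟨h0, h0'⟩
  have h1 := h.isSolution.eq_zero hV h0 h0'
  have h2 : Tendsto (fun _ : ℝ => (0 : ℂ)) atTop (𝓝 1) := by
    refine h.tendsto.congr' ?_
    filter_upwards [eventually_ge_atTop 0] with x hx
    rw [(h1 x hx).1, mul_zero]
  exact zero_ne_one (tendsto_nhds_unique tendsto_const_nhds h2)

omit hV in
/-- The asymptotics at infinity of the Wronskian of two Jost solutions. -/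
theorem tendsto_exp_mul_wronskian
    (h₁ : IsJostSolution V ζ₁ u₁ u₁') (h₂ : IsJostSolution V ζ₂ u₂ u₂') :
    Tendsto (fun x : ℝ => Complex.exp (-(Complex.I * (ζ₁ + ζ₂) * x)) * wronskian u₁ u₁' u₂ u₂' x)
      atTop (𝓝 (Complex.I * (ζ₂ - ζ₁))) := by
  have hlim := (h₁.tendsto.mul h₂.tendsto_deriv).sub (h₁.tendsto_deriv.mul h₂.tendsto)
  rw [one_mul, mul_one, ← mul_sub] at hlim
  refine hlim.congr fun x => ?_
  have : Complex.exp (-(Complex.I * (ζ₁ + ζ₂) * x)) =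
      Complex.exp (-(Complex.I * ζ₁ * x)) * Complex.exp (-(Complex.I * ζ₂ * x)) := by
    rw [← Complex.exp_add]; congr 1; ring
  rw [this, wronskian]
  ring

/-- The Jost solution is unique. -/
theorem IsJostSolution.unique (hζ : 0 ≤ ζ.im) (h₁ : IsJostSolution V ζ u₁ u₁')
    (h₂ : IsJostSolution V ζ u₂ u₂') : ∀ x, 0 ≤ x → u₁ x = u₂ x ∧ u₁' x = u₂' x := by
  -- The Wronskian is the bounded function `e^{2iζx}` times a quantity tending to `0`.
  have hW : Tendsto (wronskian u₁ u₁' u₂ u₂') atTop (𝓝 0) := by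
    have hlim := tendsto_exp_mul_wronskian h₁ h₂
    rw [sub_self, mul_zero, tendsto_zero_iff_norm_tendsto_zero] at hlim
    refine squeeze_zero_norm' ?_ hlim
    filter_upwards [eventually_ge_atTop 0] with x hx
    have h1 : wronskian u₁ u₁' u₂ u₂' x = Complex.exp (Complex.I * (ζ + ζ) * x) *
        (Complex.exp (-(Complex.I * (ζ + ζ) * x)) * wronskian u₁ u₁' u₂ u₂' x) := by
      rw [← mul_assoc, ← Complex.exp_add]; simp
    nth_rw 1 [h1]
    rw [norm_mul]
    exact mul_le_of_le_one_left (norm_nonneg _)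
      (norm_exp_I_mul_le (by rw [Complex.add_im]; linarith) hx)
  have hW0 : wronskian u₁ u₁' u₂ u₂' 0 = 0 := by
    refine tendsto_nhds_unique (tendsto_const_nhds.congr' ?_) hW
    filter_upwards [eventually_ge_atTop 0] with x hx
    exact (h₁.isSolution.wronskian_const hV h₂.isSolution rfl hx).symm
  obtain ⟨c, hc⟩ := h₁.isSolution.exists_eq_const_mul hV h₂.isSolution hW0 (h₂.not_trivial hV)
  have hc1 : c = 1 := by
    have h3 : Tendsto (fun x : ℝ => c * (Complex.exp (-(Complex.I * ζ * x)) * u₂ x)) atTop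
        (𝓝 1) := by
      refine h₁.tendsto.congr' ?_
      filter_upwards [eventually_ge_atTop 0] with x hx
      rw [(hc x hx).1]; ring
    simpa using tendsto_nhds_unique (h₂.tendsto.const_mul c) h3
  intro x hx
  simpa [hc1] using hc x hx

theorem isJostSolution_jostSolution (hζ : 0 ≤ ζ.im) :
    IsJostSolution V ζ (jostSolution V ζ).1 (jostSolution V ζ).2 := by
  have h : ∃ p : (ℝ → ℂ) × (ℝ → ℂ), IsJostSolution V ζ p.1 p.2 :=
    ⟨(_, _), isJostSolution_jostAmp hV hζ⟩
  rw [jostSolution, dif_pos h]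
  exact h.choose_spec

/-- The Jost solution chosen in the definition of the Jost function is the constructed one. -/
theorem jostSolution_eq (hζ : 0 ≤ ζ.im) {x : ℝ} (hx : 0 ≤ x) :
    (jostSolution V ζ).1 x = Complex.exp (Complex.I * ζ * x) * jostAmp V ζ x ∧
    (jostSolution V ζ).2 x = Complex.exp (Complex.I * ζ * x) *
      (Complex.I * ζ * jostAmp V ζ x + jostAmpDeriv V ζ x) :=
  (isJostSolution_jostSolution hV hζ).unique hV hζ (isJostSolution_jostAmp hV hζ) x hx

theorem jostFunction_eq (γ : ℝ) (hζ : 0 ≤ ζ.im) : jostFunction V γ ζ =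
    (γ - Complex.I * ζ) * jostAmp V ζ 0 - jostAmpDeriv V ζ 0 := by
  have h := jostSolution_eq hV hζ le_rfl
  rw [jostFunction, h.1, h.2]
  simp
  ring

omit hV in
theorem IsJostSolution.conjugate (h : IsJostSolution V ζ θ θ') :
    IsJostSolution V (-conj ζ) (fun x => conj (θ x)) (fun x => conj (θ' x)) := by
  have he : ∀ x : ℝ, Complex.exp (-(Complex.I * -conj ζ * x)) =
      conj (Complex.exp (-(Complex.I * ζ * x))) := fun x => by
    rw [← Complex.exp_conj]; simp
  refine ⟨h.isSolution.conjugate, ?_, ?_⟩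
  · have := (Complex.continuous_conj.tendsto _).comp h.tendsto
    rw [map_one] at this
    refine this.congr fun x => ?_
    rw [he, ← map_mul]
    rfl
  · have := (Complex.continuous_conj.tendsto _).comp h.tendsto_deriv
    rw [show conj (Complex.I * ζ) = Complex.I * -conj ζ by simp] at this
    refine this.congr fun x => ?_
    rw [he, ← map_mul]
    rfl

/-- On the imaginary axis the Jost solution is real. -/
theorem conj_jostSolution {τ : ℝ} (hτ : 0 ≤ τ) {x : ℝ} (hx : 0 ≤ x) :
    conj ((jostSolution V (Complex.I * τ)).1 x) = (jostSolution V (Complex.I * τ)).1 x ∧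
    conj ((jostSolution V (Complex.I * τ)).2 x) = (jostSolution V (Complex.I * τ)).2 x := by
  have hζ : 0 ≤ (Complex.I * τ).im := by simpa using hτ
  have h := isJostSolution_jostSolution hV hζ
  have h' := h.conjugate
  rw [show -conj (Complex.I * (τ : ℂ)) = Complex.I * τ by simp] at h'
  exact h'.unique hV hζ h x hx

theorem conj_jostFunction (γ : ℝ) {τ : ℝ} (hτ : 0 ≤ τ) :
    conj (jostFunction V γ (Complex.I * τ)) = jostFunction V γ (Complex.I * τ) := by
  have h := conj_jostSolution hV hτ le_rfl
  rw [jostFunction, map_sub, map_mul, h.1, h.2, Complex.conj_ofReal]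

end Solutions

/-! ### The Jost function: continuity, asymptotics, absence of zeros off the imaginary axis -/

section JostFunction

variable {V : ℝ → ℝ} (hV : IntegrableOn (fun x : ℝ => (1 + x) * V x) (Ioi 0) volume)

theorem tendsto_wronskian_zero {ζ₁ ζ₂ : ℂ} {u₁ u₁' u₂ u₂' : ℝ → ℂ}
    (h₁ : IsJostSolution V ζ₁ u₁ u₁') (h₂ : IsJostSolution V ζ₂ u₂ u₂')
    (him : 0 < (ζ₁ + ζ₂).im) : Tendsto (wronskian u₁ u₁' u₂ u₂') atTop (𝓝 0) := by
  have h1 : Tendsto (fun x : ℝ => Complex.exp (Complex.I * (ζ₁ + ζ₂) * x)) atTop (𝓝 0) := by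
    rw [tendsto_zero_iff_norm_tendsto_zero]
    have : ∀ x : ℝ, ‖Complex.exp (Complex.I * (ζ₁ + ζ₂) * x)‖ = Real.exp (-((ζ₁ + ζ₂).im * x)) :=
      fun x => by rw [Complex.norm_exp]; simp; ring
    simp only [this]
    exact Real.tendsto_exp_neg_atTop_nhds_zero.comp (tendsto_id.const_mul_atTop him)
  have h2 := h1.mul (tendsto_exp_mul_wronskian h₁ h₂)
  rw [zero_mul] at h2
  refine h2.congr fun x => ?_
  rw [← mul_assoc, ← Complex.exp_add]
  simp

include hV

theorem continuous_jostAmpDeriv_zero :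
    Continuous fun ζ : ClosedUpper => jostAmpDeriv V ζ 0 := by
  refine (continuous_of_dominated (bound := fun t => |V t| * Real.exp (momentTail V 0))
    ?_ ?_ ((integrableOn_potential hV).abs.mul_const _) ?_).neg
  · intro ζ
    exact (Continuous.aestronglyMeasurable (by fun_prop)).mul
      (integrableOn_potential_mul_jostAmp hV ζ.2).aestronglyMeasurable
  · intro ζ
    filter_upwards [ae_restrict_mem measurableSet_Ioi] with t ht
    have ht' : (0 : ℝ) < t := ht
    rw [norm_mul, norm_mul, Complex.norm_real, Real.norm_eq_abs]
    refine (mul_le_of_le_one_left (by positivity)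
      (norm_exp_two_I_mul_le ζ.2 (by linarith))).trans ?_
    exact mul_le_mul_of_nonneg_left (norm_jostAmp_le hV ζ.2 ht'.le) (abs_nonneg _)
  · refine Eventually.of_forall fun t => ?_
    have := (continuous_jostAmp hV).comp (f := fun ζ : ClosedUpper => (t, ζ)) (by fun_prop)
    have h2 : Continuous fun ζ : ClosedUpper => jostAmp V ζ t := this
    fun_prop

theorem continuous_jostFunction (γ : ℝ) :
    Continuous fun ζ : ClosedUpper => jostFunction V γ ζ := by
  have h1 : Continuous fun ζ : ClosedUpper => jostAmp V ζ 0 :=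
    (continuous_jostAmp hV).comp (f := fun ζ : ClosedUpper => ((0 : ℝ), ζ)) (by fun_prop)
  have h2 := continuous_jostAmpDeriv_zero hV
  have : (fun ζ : ClosedUpper => jostFunction V γ ζ) = fun ζ : ClosedUpper =>
      ((γ : ℂ) - Complex.I * ζ) * jostAmp V ζ 0 - jostAmpDeriv V ζ 0 :=
    funext fun ζ => jostFunction_eq hV γ ζ.2
  rw [this]
  fun_prop

omit hV in
theorem norm_le_norm_one_sub {ζ : ℂ} (hζ : 0 ≤ ζ.im) : ‖ζ‖ ≤ ‖1 - Complex.I * ζ‖ := by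
  rw [← sq_le_sq₀ (norm_nonneg _) (norm_nonneg _), ← Complex.normSq_eq_norm_sq,
    ← Complex.normSq_eq_norm_sq, Complex.normSq_apply, Complex.normSq_apply]
  simp
  nlinarith

omit hV in
theorem one_sub_I_mul_ne_zero {ζ : ℂ} (hζ : 0 ≤ ζ.im) : 1 - Complex.I * ζ ≠ 0 := by
  intro h
  have := congrArg Complex.re h
  simp at this
  linarith

/-- The Jost function is asymptotic to `1 - iζ` at infinity, in the whole closed upper
half-plane. -/
theorem tendsto_jostFunction_div (γ : ℝ) :
    Tendsto (fun ζ : ClosedUpper => jostFunction V γ ζ / (1 - Complex.I * ζ))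
      (comap (fun ζ : ClosedUpper => ‖(ζ : ℂ)‖) atTop) (𝓝 1) := by
  rw [tendsto_iff_norm_sub_tendsto_zero]
  set B := Real.exp (momentTail V 0)
  set T := tail (fun t => |V t|) 0
  have hT : 0 ≤ T := tail_nonneg (fun _ _ => abs_nonneg _) le_rfl
  have hlim : Tendsto (fun ζ : ClosedUpper => (|γ - 1| * B + B * T + B * T) / ‖(ζ : ℂ)‖)
      (comap (fun ζ : ClosedUpper => ‖(ζ : ℂ)‖) atTop) (𝓝 0) :=
    tendsto_comap.const_div_atTop _
  refine squeeze_zero' (Eventually.of_forall fun _ => norm_nonneg _) ?_ hlim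
  filter_upwards [tendsto_comap.eventually (eventually_gt_atTop (0 : ℝ))] with ζ hζ
  have h0 : (ζ : ℂ) ≠ 0 := norm_pos_iff.1 hζ
  have hd := norm_le_norm_one_sub ζ.2
  have hne := one_sub_I_mul_ne_zero ζ.2
  have h1 : jostFunction V γ ζ / (1 - Complex.I * ζ) - 1 =
      ((γ - 1 : ℝ) * jostAmp V ζ 0 - jostAmpDeriv V ζ 0) / (1 - Complex.I * ζ) +
        (jostAmp V ζ 0 - 1) := by
    rw [jostFunction_eq hV γ ζ.2]
    push_cast
    field_simp
    ring
  rw [h1]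
  refine (norm_add_le _ _).trans ?_
  rw [norm_div, add_div]
  refine add_le_add ?_ (norm_jostAmp_sub_one_le_div hV ζ.2 h0 0)
  refine div_le_div₀ (by positivity) ?_ hζ hd
  refine (norm_sub_le _ _).trans (add_le_add ?_ (norm_jostAmpDeriv_le hV ζ.2 le_rfl))
  rw [norm_mul, Complex.norm_real, Real.norm_eq_abs]
  exact mul_le_mul_of_nonneg_left (norm_jostAmp_le hV ζ.2 le_rfl) (abs_nonneg _)

omit hV in
theorem jostSolution_deriv_zero {γ : ℝ} {ζ : ℂ} (h : jostFunction V γ ζ = 0) :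
    (jostSolution V ζ).2 0 = γ * (jostSolution V ζ).1 0 := by
  rw [jostFunction, sub_eq_zero] at h
  exact h.symm

/-- If `w(ζ) = 0` then `θ(0, ζ) ≠ 0`. -/
theorem jostSolution_zero_ne_zero {γ : ℝ} {ζ : ℂ} (hζ : 0 ≤ ζ.im)
    (h : jostFunction V γ ζ = 0) : (jostSolution V ζ).1 0 ≠ 0 := by
  intro h0
  refine (isJostSolution_jostSolution hV hζ).not_trivial hV ⟨h0, ?_⟩
  rw [jostSolution_deriv_zero h, h0, mul_zero]

theorem integral_norm_sq_jostSolution_pos {γ : ℝ} {ζ : ℂ} (hζ : 0 ≤ ζ.im)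
    (h : jostFunction V γ ζ = 0) : 0 < ∫ t in (0 : ℝ)..1, ‖(jostSolution V ζ).1 t‖ ^ 2 := by
  have hc := (isJostSolution_jostSolution hV hζ).isSolution.continuousOn
  refine intervalIntegral.integral_pos one_pos
    ((hc.mono (fun x hx => hx.1)).norm.pow 2) (fun x _ => by positivity) ⟨0, by simp, ?_⟩
  have := norm_pos_iff.2 (jostSolution_zero_ne_zero hV hζ h)
  positivity

/-- The Jost function has no zeros off the imaginary axis: for real `ζ ≠ 0` because the Wronskian of
`θ` and `θ̄` does not vanish, for non-real `ζ` because `ζ²` would be a non-real eigenvalue. -/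
theorem jostFunction_ne_zero {γ : ℝ} {ζ : ℂ} (hζ : 0 ≤ ζ.im) (hre : ζ.re ≠ 0) :
    jostFunction V γ ζ ≠ 0 := by
  intro h
  have hJ := isJostSolution_jostSolution hV hζ
  have hJ' := hJ.conjugate
  have hpos := integral_norm_sq_jostSolution_pos hV hζ h
  have hbc := jostSolution_deriv_zero h
  set θ := (jostSolution V ζ).1
  set θ' := (jostSolution V ζ).2
  have hW0 : wronskian θ θ' (fun x => conj (θ x)) (fun x => conj (θ' x)) 0 = 0 := by
    simp only [wronskian, hbc, map_mul, Complex.conj_ofReal]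
    ring
  have hsum : ζ + -conj ζ = Complex.I * (2 * ζ.im : ℝ) := by
    apply Complex.ext <;> simp
    ring
  have hWx : ∀ x : ℝ, 0 ≤ x → wronskian θ θ' (fun x => conj (θ x)) (fun x => conj (θ' x)) x =
      (4 * ζ.re * ζ.im : ℝ) * Complex.I * (∫ t in (0 : ℝ)..x, ‖θ t‖ ^ 2 : ℝ) := by
    intro x hx
    rw [hJ.isSolution.wronskian_eq hV hJ'.isSolution hx, hW0, zero_add,
      ← intervalIntegral.integral_ofReal]
    congr 1
    · apply Complex.ext <;> simp [pow_two]
      ring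
    · congr 1
      ext t
      rw [Complex.mul_conj, Complex.normSq_eq_norm_sq]
  rcases hζ.eq_or_lt with him | him
  · have h1 := tendsto_exp_mul_wronskian hJ hJ'
    have h2 : Tendsto (fun _ : ℝ => (0 : ℂ)) atTop (𝓝 (Complex.I * (-conj ζ - ζ))) := by
      refine h1.congr' ?_
      filter_upwards [eventually_ge_atTop 0] with x hx
      rw [hWx x hx, ← him]
      simp
    have h3 := congrArg Complex.im (tendsto_nhds_unique tendsto_const_nhds h2)
    simp at h3
    exact hre (by linarith)
  · have h1 := tendsto_wronskian_zero hJ hJ' (by rw [hsum]; simpa using him)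
    have h2 := h1.norm
    rw [norm_zero] at h2
    have h3 : |4 * ζ.re * ζ.im| * ∫ t in (0 : ℝ)..1, ‖θ t‖ ^ 2 ≤ 0 := by
      refine ge_of_tendsto h2 ?_
      filter_upwards [eventually_ge_atTop 1] with x hx
      have hx0 : (0 : ℝ) ≤ x := by linarith
      rw [hWx x hx0, norm_mul, norm_mul, Complex.norm_real, Complex.norm_real, Complex.norm_I,
        mul_one, Real.norm_eq_abs, Real.norm_eq_abs]
      refine mul_le_mul_of_nonneg_left ((le_abs_self _).trans' ?_) (abs_nonneg _)
      refine intervalIntegral.integral_mono_interval le_rfl zero_le_one hx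
        (Eventually.of_forall fun t => by positivity) ?_
      refine ContinuousOn.intervalIntegrable ?_
      rw [uIcc_of_le hx0]
      exact (hJ.isSolution.continuousOn.mono (fun x hx => hx.1)).norm.pow 2
    have h4 : 0 < |4 * ζ.re * ζ.im| := abs_pos.2 (by positivity)
    nlinarith [mul_pos h4 hpos]

end JostFunction

/-! ### Simplicity of the zeros -/

section Zeros

variable {V : ℝ → ℝ} (hV : IntegrableOn (fun x : ℝ => (1 + x) * V x) (Ioi 0) volume)

theorem norm_exp_I_mul_le_exp {ζ : ℂ} {x : ℝ} :
    ‖Complex.exp (Complex.I * ζ * x)‖ = Real.exp (-(ζ.im * x)) := by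
  rw [Complex.norm_exp]; simp

theorem norm_exp_sub_one_le {ζ : ℂ} (hζ : 0 ≤ ζ.im) {x : ℝ} (hx : 0 ≤ x) :
    ‖Complex.exp (Complex.I * ζ * x) - 1‖ ≤ ‖ζ‖ * x := by
  have h := mul_jostKernel (x / 2) ζ
  have h2 : (2 * Complex.I * ζ * (x / 2 : ℝ)) = Complex.I * ζ * x := by push_cast; ring
  rw [h2] at h
  rw [← h, norm_mul, norm_mul, norm_mul, Complex.norm_I, Complex.norm_ofNat]
  have := norm_jostKernel_le hζ (s := x / 2) (by linarith)
  nlinarith [norm_nonneg ζ]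

include hV

theorem norm_jostSolution_le {ζ : ℂ} (hζ : 0 ≤ ζ.im) {x : ℝ} (hx : 0 ≤ x) :
    ‖(jostSolution V ζ).1 x‖ ≤ Real.exp (momentTail V 0) * Real.exp (-(ζ.im * x)) := by
  rw [(jostSolution_eq hV hζ hx).1, norm_mul, norm_exp_I_mul_le_exp, mul_comm]
  exact mul_le_mul_of_nonneg_right (norm_jostAmp_le hV hζ hx) (Real.exp_pos _).le

omit hV in
/-- At a zero `ζ₀` of the Jost function, `θ(·, ζ₀)` satisfies the boundary condition, and therefore
`w(ζ)` is a multiple of a Wronskian. -/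
theorem wronskian_of_jostFunction_eq_zero {γ : ℝ} {ζ ζ₀ : ℂ} (h : jostFunction V γ ζ₀ = 0) :
    wronskian (jostSolution V ζ).1 (jostSolution V ζ).2 (jostSolution V ζ₀).1
      (jostSolution V ζ₀).2 0 = (jostSolution V ζ₀).1 0 * jostFunction V γ ζ := by
  rw [wronskian, jostSolution_deriv_zero h, jostFunction]
  ring

theorem integrableOn_jostSolution_mul {ζ ζ₀ : ℂ} (hζ : 0 ≤ ζ.im) (hζ₀ : 0 < ζ₀.im) :
    IntegrableOn (fun t => (jostSolution V ζ).1 t * (jostSolution V ζ₀).1 t) (Ioi 0) volume := by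
  refine Integrable.mono' (g := fun t => Real.exp (momentTail V 0) * (Real.exp (momentTail V 0) *
    Real.exp (-ζ₀.im * t))) (((exp_neg_integrableOn_Ioi 0 hζ₀).const_mul _).const_mul _) ?_ ?_
  · exact (((isJostSolution_jostSolution hV hζ).isSolution.continuousOn.mul
      (isJostSolution_jostSolution hV hζ₀.le).isSolution.continuousOn).mono
      Ioi_subset_Ici_self).aestronglyMeasurable measurableSet_Ioi
  · filter_upwards [ae_restrict_mem measurableSet_Ioi] with t ht
    have ht' : (0 : ℝ) < t := ht
    rw [norm_mul, neg_mul]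
    refine mul_le_mul ((norm_jostSolution_le hV hζ ht'.le).trans ?_)
      (norm_jostSolution_le hV hζ₀.le ht'.le) (norm_nonneg _) (Real.exp_pos _).le
    refine mul_le_of_le_one_right (Real.exp_pos _).le (Real.exp_le_one_iff.2 ?_)
    have := mul_nonneg hζ ht'.le
    linarith

/-- Green's formula on the half-line, for a solution satisfying the boundary condition. -/
theorem jostSolution_mul_jostFunction {γ : ℝ} {ζ ζ₀ : ℂ} (hζ : 0 ≤ ζ.im) (hζ₀ : 0 < ζ₀.im)
    (h : jostFunction V γ ζ₀ = 0) : (jostSolution V ζ₀).1 0 * jostFunction V γ ζ =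
      -((ζ ^ 2 - ζ₀ ^ 2) * ∫ t in Ioi (0 : ℝ), (jostSolution V ζ).1 t * (jostSolution V ζ₀).1 t) := by
  have hJ := isJostSolution_jostSolution hV hζ
  have hJ₀ := isJostSolution_jostSolution hV hζ₀.le
  have h1 := tendsto_wronskian_zero hJ hJ₀ (by rw [Complex.add_im]; linarith)
  have h2 := intervalIntegral_tendsto_integral_Ioi 0
    (integrableOn_jostSolution_mul hV hζ hζ₀) tendsto_id
  have h3 := (h2.const_mul (ζ ^ 2 - ζ₀ ^ 2)).const_add
    ((jostSolution V ζ₀).1 0 * jostFunction V γ ζ)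
  have h4 := tendsto_nhds_unique (h3.congr' ?_) h1
  · linear_combination h4
  · filter_upwards [eventually_ge_atTop 0] with x hx
    rw [hJ.isSolution.wronskian_eq hV hJ₀.isSolution hx, wronskian_of_jostFunction_eq_zero h]
    rfl

theorem integral_jostSolution_sq_ne_zero {γ κ : ℝ} (hκ : 0 < κ)
    (h : jostFunction V γ (Complex.I * κ) = 0) :
    ∫ t in Ioi (0 : ℝ), (jostSolution V (Complex.I * κ)).1 t *
      (jostSolution V (Complex.I * κ)).1 t ≠ 0 := by
  have him : 0 < (Complex.I * (κ : ℂ)).im := by simpa using hκ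
  have hpos := integral_norm_sq_jostSolution_pos hV him.le h
  have hint := integrableOn_jostSolution_mul hV him.le him
  have hreal : ∀ t : ℝ, 0 < t → (jostSolution V (Complex.I * κ)).1 t *
      (jostSolution V (Complex.I * κ)).1 t = (‖(jostSolution V (Complex.I * κ)).1 t‖ ^ 2 : ℝ) := by
    intro t ht
    rw [← Complex.normSq_eq_norm_sq, ← Complex.mul_conj, (conj_jostSolution hV hκ.le ht.le).1]
  rw [setIntegral_congr_fun measurableSet_Ioi hreal, integral_complex_ofReal, Complex.ofReal_ne_zero]
  refine ne_of_gt (hpos.trans_le ?_)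
  rw [intervalIntegral.integral_of_le zero_le_one]
  refine setIntegral_mono_set ?_ (Eventually.of_forall fun t => by positivity)
    Ioc_subset_Ioi_self.eventuallyLE
  refine (hint.norm).congr ?_
  filter_upwards with t
  rw [norm_mul, pow_two]

/-- The zeros of the Jost function on the positive imaginary axis are simple. -/
theorem exists_tendsto_jostFunction_div {γ κ : ℝ} (hκ : 0 < κ)
    (h : jostFunction V γ (Complex.I * κ) = 0) (z : ClosedUpper) (hz : (z : ℂ) = Complex.I * κ) :
    ∃ c : ℂ, c ≠ 0 ∧ Tendsto (fun ζ : ClosedUpper => jostFunction V γ ζ / (ζ - z : ℂ)) (𝓝[≠] z)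
      (𝓝 c) := by
  have him : 0 < (z : ℂ).im := by rw [hz]; simpa using hκ
  rw [← hz] at h
  have hθ0 := jostSolution_zero_ne_zero hV z.2 h
  have hI := integral_jostSolution_sq_ne_zero hV hκ (hz ▸ h)
  rw [← hz] at hI
  set θ₀ := (jostSolution V z).1 with hθ₀
  have hcont : Continuous fun ζ : ClosedUpper =>
      ∫ t in Ioi (0 : ℝ), (jostSolution V ζ).1 t * θ₀ t := by
    refine continuous_of_dominated (bound := fun t => Real.exp (momentTail V 0) *
      (Real.exp (momentTail V 0) * Real.exp (-(z : ℂ).im * t))) ?_ ?_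
      (((exp_neg_integrableOn_Ioi 0 him).const_mul _).const_mul _) ?_
    · exact fun ζ => (integrableOn_jostSolution_mul hV ζ.2 him).aestronglyMeasurable
    · intro ζ
      filter_upwards [ae_restrict_mem measurableSet_Ioi] with t ht
      have ht' : (0 : ℝ) < t := ht
      rw [norm_mul, neg_mul]
      refine mul_le_mul ((norm_jostSolution_le hV ζ.2 ht'.le).trans ?_)
        (norm_jostSolution_le hV him.le ht'.le) (norm_nonneg _) (Real.exp_pos _).le
      refine mul_le_of_le_one_right (Real.exp_pos _).le (Real.exp_le_one_iff.2 ?_)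
      have := mul_nonneg ζ.2 ht'.le
      linarith
    · filter_upwards [ae_restrict_mem measurableSet_Ioi] with t ht
      have ht' : (0 : ℝ) < t := ht
      have h1 : (fun ζ : ClosedUpper => (jostSolution V ζ).1 t * θ₀ t) = fun ζ : ClosedUpper =>
          Complex.exp (Complex.I * ζ * t) * jostAmp V ζ t * θ₀ t :=
        funext fun ζ => by rw [(jostSolution_eq hV ζ.2 ht'.le).1]
      rw [h1]
      have h2 : Continuous fun ζ : ClosedUpper => jostAmp V ζ t :=
        (continuous_jostAmp hV).comp (f := fun ζ : ClosedUpper => (t, ζ)) (by fun_prop)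
      fun_prop
  refine ⟨-((z + z : ℂ) * ∫ t in Ioi (0 : ℝ), θ₀ t * θ₀ t) / θ₀ 0, ?_, ?_⟩
  · refine div_ne_zero (neg_ne_zero.2 (mul_ne_zero ?_ hI)) hθ0
    rw [hz, ← two_mul]
    simp [hκ.ne']
  · have h1 : Continuous fun ζ : ClosedUpper =>
        -((ζ + z : ℂ) * ∫ t in Ioi (0 : ℝ), (jostSolution V ζ).1 t * θ₀ t) / θ₀ 0 := by fun_prop
    refine ((h1.tendsto z).mono_left nhdsWithin_le_nhds).congr' ?_
    filter_upwards [self_mem_nhdsWithin] with ζ hζ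
    have hne : (ζ - z : ℂ) ≠ 0 := sub_ne_zero.2 fun he => hζ (Subtype.ext he)
    have h2 := jostSolution_mul_jostFunction hV ζ.2 him h
    rw [div_eq_div_iff hθ0 hne]
    linear_combination -h2

/-- Comparison of the Jost function near `ζ = 0` with its behavior in the exceptional case `w(0) = 0`.
The Wronskian of `θ(·, ζ)` and `θ(·, 0)` is computed at `0` and at an arbitrary point `X`. -/
theorem norm_jostFunction_add_le {γ : ℝ} (h : jostFunction V γ 0 = 0) {ζ : ℂ} (hζ : 0 ≤ ζ.im)
    {X : ℝ} (hX : 0 < X) :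
    ‖(jostSolution V 0).1 0 * jostFunction V γ ζ + Complex.I * ζ‖ ≤
      2 * Real.exp (momentTail V 0) ^ 2 *
        (‖ζ‖ ^ 2 * X + momentTail V X / X + ‖ζ‖ * momentTail V X) := by
  have h0 : 0 ≤ (0 : ℂ).im := le_rfl
  have hJ := isJostSolution_jostSolution hV hζ
  have hJ₀ := isJostSolution_jostSolution hV h0
  have hW := hJ.isSolution.wronskian_eq hV hJ₀.isSolution hX.le
  rw [wronskian_of_jostFunction_eq_zero h, wronskian, (jostSolution_eq hV hζ hX.le).1,
    (jostSolution_eq hV hζ hX.le).2, (jostSolution_eq hV h0 hX.le).1,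
    (jostSolution_eq hV h0 hX.le).2] at hW
  have hK0 := momentTail_nonneg (V := V) hX.le
  have hB1 : 1 ≤ Real.exp (momentTail V 0) := Real.one_le_exp (momentTail_nonneg le_rfl)
  have hT : tail (fun t => |V t|) X ≤ momentTail V X / X := by
    rw [le_div_iff₀ hX, mul_comm, tail, ← integral_const_mul]
    refine setIntegral_mono_on ?_ ?_ measurableSet_Ioi fun t ht =>
      mul_le_mul_of_nonneg_right (mem_Ioi.1 ht).le (abs_nonneg _)
    · exact (IntegrableOn.mono_set (integrableOn_potential hV).abs
        (Ioi_subset_Ioi hX.le)).const_mul _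
    · exact (integrableOn_mul_abs_potential hV).mono_set (Ioi_subset_Ioi hX.le)
  have hint : ‖∫ t in (0 : ℝ)..X, (jostSolution V ζ).1 t * (jostSolution V 0).1 t‖ ≤
      Real.exp (momentTail V 0) ^ 2 * X := by
    have := intervalIntegral.norm_integral_le_of_norm_le_const (a := 0) (b := X)
      (C := Real.exp (momentTail V 0) ^ 2)
      (f := fun t => (jostSolution V ζ).1 t * (jostSolution V 0).1 t) fun t ht => by
        rw [uIoc_of_le hX.le] at ht
        rw [norm_mul, pow_two]
        have h1 := norm_jostSolution_le hV hζ ht.1.le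
        have h2 := norm_jostSolution_le hV h0 ht.1.le
        have h3 : Real.exp (-(ζ.im * t)) ≤ 1 := by
          rw [Real.exp_le_one_iff]
          have := mul_nonneg hζ ht.1.le
          linarith
        refine mul_le_mul (h1.trans (mul_le_of_le_one_right (Real.exp_pos _).le h3))
          (h2.trans (by simp)) (norm_nonneg _) (Real.exp_pos _).le
    simpa [abs_of_pos hX] using this
  have hm1 := norm_jostAmp_le hV hζ hX.le
  have hm2 := norm_jostAmp_le hV h0 hX.le
  have hd1 := (norm_jostAmpDeriv_le hV hζ hX.le).trans (mul_le_mul_of_nonneg_left hT (by positivity))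
  have hd2 := (norm_jostAmpDeriv_le hV h0 hX.le).trans (mul_le_mul_of_nonneg_left hT (by positivity))
  have he1 := norm_jostAmp_sub_one_le hV hζ hX.le
  have he2 := norm_jostAmp_sub_one_le hV h0 hX.le
  have hE := norm_exp_I_mul_le hζ hX.le
  have hE' := norm_exp_sub_one_le hζ hX.le
  set B := Real.exp (momentTail V 0)
  set k := momentTail V X
  generalize (∫ t in (0 : ℝ)..X, (jostSolution V ζ).1 t * (jostSolution V 0).1 t) = J at *
  generalize Complex.exp (Complex.I * ζ * X) = E at *
  generalize jostAmp V ζ X = m at *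
  generalize jostAmp V 0 X = m₀ at *
  generalize jostAmpDeriv V ζ X = d at *
  generalize jostAmpDeriv V 0 X = d₀ at *
  have hid : (jostSolution V 0).1 0 * jostFunction V γ ζ + Complex.I * ζ =
      E * (m * d₀ - d * m₀) - Complex.I * ζ * ((E - 1) * (m * m₀) + ((m - 1) * m₀ + (m₀ - 1)))
        - ζ ^ 2 * J := by
    simp only [mul_zero, zero_mul, Complex.exp_zero, one_mul, zero_add] at hW
    linear_combination -hW
  rw [hid]
  have b1 : ‖E * (m * d₀ - d * m₀)‖ ≤ 1 * (B * (B * (k / X)) + B * (k / X) * B) := by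
    rw [norm_mul]
    refine mul_le_mul hE ((norm_sub_le _ _).trans ?_) (norm_nonneg _) zero_le_one
    rw [norm_mul, norm_mul]
    gcongr
  have b2 : ‖Complex.I * ζ * ((E - 1) * (m * m₀) + ((m - 1) * m₀ + (m₀ - 1)))‖ ≤
      ‖ζ‖ * (‖ζ‖ * X * (B * B) + (B * k * B + B * k)) := by
    rw [norm_mul, norm_mul, Complex.norm_I, one_mul]
    gcongr
    refine (norm_add_le _ _).trans (add_le_add ?_ ((norm_add_le _ _).trans (add_le_add ?_ he2)))
    · rw [norm_mul, norm_mul]; gcongr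
    · rw [norm_mul]; gcongr
  have b3 : ‖ζ ^ 2 * J‖ ≤ ‖ζ‖ ^ 2 * (B ^ 2 * X) := by
    rw [norm_mul, norm_pow]; gcongr
  refine (norm_sub_le _ _).trans ((add_le_add ((norm_sub_le _ _).trans (add_le_add b1 b2))
    b3).trans ?_)
  have h5 : ‖ζ‖ * (B * k) ≤ ‖ζ‖ * (B * k) * B := le_mul_of_one_le_right (by positivity) hB1
  nlinarith

/-- If the Jost function vanishes at `0`, it does so exactly to first order. -/
theorem exists_tendsto_jostFunction_div_zero {γ : ℝ} (h : jostFunction V γ 0 = 0)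
    (z : ClosedUpper) (hz : (z : ℂ) = 0) :
    ∃ c : ℂ, c ≠ 0 ∧ Tendsto (fun ζ : ClosedUpper => jostFunction V γ ζ / (ζ - z : ℂ)) (𝓝[≠] z)
      (𝓝 c) := by
  have hθ0 := jostSolution_zero_ne_zero hV (ζ := 0) le_rfl h
  refine ⟨-Complex.I / (jostSolution V 0).1 0, div_ne_zero (by simp) hθ0, ?_⟩
  suffices hs : Tendsto (fun ζ : ClosedUpper => (jostSolution V 0).1 0 * jostFunction V γ ζ / ζ)
      (𝓝[≠] z) (𝓝 (-Complex.I)) by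
    refine (hs.div_const ((jostSolution V 0).1 0)).congr fun ζ => ?_
    rw [hz, sub_zero]
    field_simp
  have hnorm : Tendsto (fun ζ : ClosedUpper => ‖(ζ : ℂ)‖) (𝓝[≠] z) (𝓝[>] 0) := by
    refine tendsto_nhdsWithin_iff.2 ⟨?_, ?_⟩
    · have : Continuous fun ζ : ClosedUpper => ‖(ζ : ℂ)‖ := by fun_prop
      simpa [hz] using (this.tendsto z).mono_left nhdsWithin_le_nhds
    · filter_upwards [self_mem_nhdsWithin] with ζ hζ
      exact norm_pos_iff.2 fun he => hζ (Subtype.ext (he.trans hz.symm))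
  rw [Metric.tendsto_nhds]
  intro ε hε
  set B := Real.exp (momentTail V 0)
  have hB : 0 < B := Real.exp_pos _
  -- The point `X = δ / |ζ|` makes the first error term a small multiple of `|ζ|`; the other ones
  -- are `o(|ζ|)` for fixed `δ`.
  set δ := ε / (4 * B ^ 2) with hδ
  have hδ0 : 0 < δ := by positivity
  have hk : Tendsto (fun r : ℝ => 2 * B ^ 2 * (momentTail V (δ / r) * (1 / δ + 1))) (𝓝[>] 0)
      (𝓝 0) := by
    have h1 : Tendsto (fun r : ℝ => δ / r) (𝓝[>] 0) atTop :=
      (tendsto_inv_nhdsGT_zero.const_mul_atTop hδ0)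
    have h2 := (((tendsto_momentTail hV).comp h1).mul_const (1 / δ + 1)).const_mul (2 * B ^ 2)
    simpa using h2
  have hk' := (hk.comp hnorm).eventually (gt_mem_nhds (half_pos hε))
  filter_upwards [hk', hnorm.eventually self_mem_nhdsWithin] with ζ h1 h2
  have h2' : 0 < ‖(ζ : ℂ)‖ := h2
  have h3 := norm_jostFunction_add_le hV h ζ.2 (div_pos hδ0 h2')
  have hne : (ζ : ℂ) ≠ 0 := norm_pos_iff.1 h2'
  rw [dist_eq_norm, show (jostSolution V 0).1 0 * jostFunction V γ ζ / ζ - -Complex.I =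
    ((jostSolution V 0).1 0 * jostFunction V γ ζ + Complex.I * ζ) / ζ by field_simp; ring,
    norm_div, div_lt_iff₀ h2']
  refine h3.trans_lt ?_
  simp only [Function.comp_apply] at h1
  have h4 : 2 * B ^ 2 * δ = ε / 2 := by rw [hδ]; field_simp; ring
  generalize momentTail V (δ / ‖(ζ : ℂ)‖) = k at *
  have h5 : 2 * B ^ 2 * (‖(ζ : ℂ)‖ ^ 2 * (δ / ‖(ζ : ℂ)‖) + k / (δ / ‖(ζ : ℂ)‖) + ‖(ζ : ℂ)‖ * k) =
      ‖(ζ : ℂ)‖ * (2 * B ^ 2 * δ + 2 * B ^ 2 * (k * (1 / δ + 1))) := by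
    field_simp
    ring
  rw [h5, h4, mul_comm]
  exact mul_lt_mul_of_pos_right (by linarith) h2'

end Zeros

/-! ### From zeros of the Jost function to eigenfunctions -/

theorem IsPrim.conjugate {f f' : ℝ → ℂ} (h : IsPrim f f') :
    IsPrim (fun x => conj (f x)) (fun x => conj (f' x)) := by
  refine ⟨fun x hx => ⟨?_, ?_⟩, fun x hx => ?_⟩
  · exact Complex.conjCLE.toContinuousLinearMap.integrable_comp (h.integrable x hx).1
  · exact Complex.conjCLE.toContinuousLinearMap.integrable_comp (h.integrable x hx).2
  · rw [h.eq_integral x hx, map_add]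
    simp only [intervalIntegral, ← integral_conj, map_sub]

theorem memLp_conj {f : ℝ → ℂ} (h : MemLp f 2 halfLine) :
    MemLp (fun x => conj (f x)) 2 halfLine :=
  h.congr_norm (Complex.continuous_conj.comp_aestronglyMeasurable h.aestronglyMeasurable)
    (Eventually.of_forall fun x => by simp)

theorem integrable_mul_of_memLp_two {f g : ℝ → ℂ} (hf : MemLp f 2 halfLine)
    (hg : MemLp g 2 halfLine) : Integrable (fun x => f x * g x) halfLine :=
  hf.integrable_mul hg

section Sobolev

variable {v v' : ℝ → ℂ}

theorem IsH1.isPrim (h : IsH1 v v') : IsPrim v v' := by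
  refine ⟨fun x hx => ?_, h.eq_integral⟩
  rw [intervalIntegrable_iff_integrableOn_Ioc_of_le hx]
  have h1 : MemLp v' 2 (volume.restrict (Ioc 0 x)) :=
    h.memLp_deriv.mono_measure (Measure.restrict_mono Ioc_subset_Ioi_self le_rfl)
  exact h1.integrable (by norm_num)

/-- Functions in `H¹(ℝ₊)` are bounded. -/
theorem IsH1.exists_bound (h : IsH1 v v') : ∃ C : ℝ, ∀ x, 0 ≤ x → ‖v x‖ ≤ C := by
  have hp := h.isPrim.mul h.isPrim.conjugate
  have hi : IntegrableOn (fun x => v' x * conj (v x) + v x * conj (v' x)) (Ioi 0) volume :=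
    (integrable_mul_of_memLp_two h.memLp_deriv (memLp_conj h.memLp)).add
      (integrable_mul_of_memLp_two h.memLp (memLp_conj h.memLp_deriv))
  refine ⟨Real.sqrt (‖v 0 * conj (v 0)‖ +
    ∫ x in Ioi (0 : ℝ), ‖v' x * conj (v x) + v x * conj (v' x)‖), fun x hx => ?_⟩
  refine Real.le_sqrt_of_sq_le ?_
  have h1 : ‖v x‖ ^ 2 = ‖v x * conj (v x)‖ := by rw [norm_mul, RCLike.norm_conj, pow_two]
  rw [h1, hp.eq_integral x hx]
  refine (norm_add_le _ _).trans (add_le_add le_rfl ?_)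
  refine (intervalIntegral.norm_integral_le_integral_norm hx).trans ?_
  rw [intervalIntegral.integral_of_le hx]
  exact setIntegral_mono_set hi.norm (Eventually.of_forall fun t => norm_nonneg _)
    Ioc_subset_Ioi_self.eventuallyLE

theorem memLp_two_of_norm_le_exp {f : ℝ → ℂ} {C κ : ℝ} (hκ : 0 < κ)
    (hf : ContinuousOn f (Ici 0)) (hC : ∀ x, 0 ≤ x → ‖f x‖ ≤ C * Real.exp (-(κ * x))) :
    MemLp f 2 halfLine := by
  have hg : MemLp (fun x : ℝ => C * Real.exp (-(κ * x))) 2 halfLine := by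
    rw [memLp_two_iff_integrable_sq (Continuous.aestronglyMeasurable (by fun_prop))]
    have := (exp_neg_integrableOn_Ioi 0 (b := 2 * κ) (by positivity)).const_mul (C ^ 2)
    refine this.congr (Eventually.of_forall fun x => ?_)
    simp only [mul_pow, ← Real.exp_nat_mul]
    congr 2
    push_cast; ring
  refine hg.mono ((hf.mono Ioi_subset_Ici_self).aestronglyMeasurable measurableSet_Ioi) ?_
  filter_upwards [ae_restrict_mem measurableSet_Ioi] with x hx
  exact (hC x (mem_Ioi.1 hx).le).trans (le_abs_self _)

end Sobolev

section Eigenvalues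

variable {V : ℝ → ℝ} (hV : IntegrableOn (fun x : ℝ => (1 + x) * V x) (Ioi 0) volume)
include hV

theorem norm_jostSolution_deriv_le {ζ : ℂ} (hζ : 0 ≤ ζ.im) {x : ℝ} (hx : 0 ≤ x) :
    ‖(jostSolution V ζ).2 x‖ ≤ (‖ζ‖ * Real.exp (momentTail V 0) +
      Real.exp (momentTail V 0) * tail (fun t => |V t|) 0) * Real.exp (-(ζ.im * x)) := by
  rw [(jostSolution_eq hV hζ hx).2, norm_mul, norm_exp_I_mul_le_exp, mul_comm]
  refine mul_le_mul_of_nonneg_right ((norm_add_le _ _).trans (add_le_add ?_ ?_)) (Real.exp_pos _).le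
  · rw [norm_mul, norm_mul, Complex.norm_I, one_mul]
    exact mul_le_mul_of_nonneg_left (norm_jostAmp_le hV hζ hx) (norm_nonneg _)
  · refine (norm_jostAmpDeriv_le hV hζ hx).trans
      (mul_le_mul_of_nonneg_left ?_ (Real.exp_pos _).le)
    exact tail_antitoneOn (integrableOn_potential hV).abs (fun _ _ => abs_nonneg _)
      self_mem_Ici hx hx

theorem isH1_jostSolution {ζ : ℂ} (hζ : 0 < ζ.im) :
    IsH1 (jostSolution V ζ).1 (jostSolution V ζ).2 := by
  have hs := (isJostSolution_jostSolution hV hζ.le).isSolution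
  exact ⟨memLp_two_of_norm_le_exp hζ (hs.isPrim hV).continuousOn
      fun x hx => norm_jostSolution_le hV hζ.le hx,
    memLp_two_of_norm_le_exp hζ (hs.isPrim_deriv hV).continuousOn
      fun x hx => norm_jostSolution_deriv_le hV hζ.le hx, (hs.isPrim hV).eq_integral⟩

theorem integrableOn_potential_mul_mul {u v : ℝ → ℂ} (hu : ContinuousOn u (Ici 0))
    (hv : ContinuousOn v (Ici 0)) {C D : ℝ} (hC : ∀ x, 0 ≤ x → ‖u x‖ ≤ C)
    (hD : ∀ x, 0 ≤ x → ‖v x‖ ≤ D) :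
    IntegrableOn (fun x => (V x : ℂ) * u x * conj (v x)) (Ioi 0) volume := by
  have := integrableOn_potential_mul hV (m := fun x => u x * conj (v x)) (C := C * D)
    (hu.mul (Complex.continuous_conj.comp_continuousOn hv)) (fun t ht => by
      rw [norm_mul, RCLike.norm_conj]
      exact mul_le_mul (hC t ht) (hD t ht) (norm_nonneg _) ((norm_nonneg _).trans (hC t ht)))
  simpa only [mul_assoc] using this

/-- A Jost solution satisfying the boundary condition is a weak solution of the eigenvalue
equation. -/
theorem robinForm_jostSolution {γ κ : ℝ} (hκ : 0 < κ) (h : jostFunction V γ (Complex.I * κ) = 0)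
    {v v' : ℝ → ℂ} (hv : IsH1 v v') :
    robinForm V γ (jostSolution V (Complex.I * κ)).1 (jostSolution V (Complex.I * κ)).2 v v' =
      ∫ x in Ioi (0 : ℝ), -(κ : ℂ) ^ 2 * (jostSolution V (Complex.I * κ)).1 x * conj (v x) := by
  have him : 0 < (Complex.I * (κ : ℂ)).im := by simpa using hκ
  have hs := (isJostSolution_jostSolution hV him.le).isSolution
  have hH := isH1_jostSolution hV him
  have hbc := jostSolution_deriv_zero h
  have hdecay := fun x hx => norm_jostSolution_deriv_le hV him.le (x := x) hx
  obtain ⟨C, hC⟩ := hH.exists_bound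
  obtain ⟨D, hD⟩ := hv.exists_bound
  have hp := (hs.isPrim_deriv hV).mul hv.isPrim.conjugate
  set θ := (jostSolution V (Complex.I * κ)).1
  set θ' := (jostSolution V (Complex.I * κ)).2
  have i1 : IntegrableOn (fun x => θ' x * conj (v' x)) (Ioi 0) volume :=
    integrable_mul_of_memLp_two hH.memLp_deriv (memLp_conj hv.memLp_deriv)
  have i2 := integrableOn_potential_mul_mul hV hH.isPrim.continuousOn hv.isPrim.continuousOn hC hD
  have i3 : IntegrableOn (fun x => θ x * conj (v x)) (Ioi 0) volume :=
    integrable_mul_of_memLp_two hH.memLp (memLp_conj hv.memLp)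
  have i4 : IntegrableOn (fun x => -(κ : ℂ) ^ 2 * θ x * conj (v x)) (Ioi 0) volume := by
    simpa only [mul_assoc, IntegrableOn] using i3.const_mul (-(κ : ℂ) ^ 2)
  have i5 := (i1.add i2).sub i4
  have hlim := intervalIntegral_tendsto_integral_Ioi 0 i5 tendsto_id
  have hzero : Tendsto (fun x => θ' x * conj (v x)) atTop (𝓝 0) := by
    have h1 : Tendsto (fun x : ℝ => Real.exp (-((Complex.I * (κ : ℂ)).im * x))) atTop (𝓝 0) :=
      Real.tendsto_exp_neg_atTop_nhds_zero.comp (tendsto_id.const_mul_atTop him)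
    have h2 := (h1.const_mul (‖Complex.I * (κ : ℂ)‖ * Real.exp (momentTail V 0) +
      Real.exp (momentTail V 0) * tail (fun t => |V t|) 0)).mul_const D
    rw [mul_zero, zero_mul] at h2
    refine squeeze_zero_norm' ?_ h2
    filter_upwards [eventually_ge_atTop 0] with x hx
    rw [norm_mul, RCLike.norm_conj]
    exact mul_le_mul (hdecay x hx) (hD x hx) (norm_nonneg _)
      ((norm_nonneg _).trans (hdecay x hx))
  have h6 := hzero.sub_const (θ' 0 * conj (v 0))
  have h7 := tendsto_nhds_unique (hlim.congr' ?_) h6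
  · rw [integral_sub' (i1.add i2) i4] at h7
    rw [robinForm]
    simp only [Pi.add_apply] at h7
    rw [hbc] at h7
    linear_combination h7
  · filter_upwards [eventually_ge_atTop 0] with x hx
    rw [hp.eq_integral x hx, add_sub_cancel_left]
    refine intervalIntegral.integral_congr fun t _ => ?_
    simp only [Pi.add_apply, Pi.sub_apply, mul_pow, Complex.I_sq]
    ring

theorem exists_isEigenvector {γ κ : ℝ} (hκ : 0 < κ) (h : jostFunction V γ (Complex.I * κ) = 0) :
    ∃ f : L2, IsEigenvector V γ (-κ ^ 2) f := by
  have him : 0 < (Complex.I * (κ : ℂ)).im := by simpa using hκ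
  have hH := isH1_jostSolution hV him
  have hpos := integral_norm_sq_jostSolution_pos hV him.le h
  have hf := hH.memLp.coeFn_toLp
  refine ⟨hH.memLp.toLp, fun h0 => ?_, _, _, hH, hf, fun v v' hv => ?_⟩
  · rw [h0] at hf
    have h1 : ∀ᵐ x ∂halfLine, (jostSolution V (Complex.I * κ)).1 x = 0 := by
      filter_upwards [hf, Lp.coeFn_zero ℂ 2 halfLine] with x h2 h3
      rw [← h2, h3]; rfl
    have h2 : ∫ t in (0 : ℝ)..1, ‖(jostSolution V (Complex.I * κ)).1 t‖ ^ 2 = 0 := by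
      rw [intervalIntegral.integral_of_le zero_le_one]
      refine integral_eq_zero_of_ae ?_
      filter_upwards [ae_mono (Measure.restrict_mono Ioc_subset_Ioi_self le_rfl) h1] with x hx
      simp [hx]
    exact hpos.ne' h2
  · rw [robinForm_jostSolution hV hκ h hv]
    refine integral_congr_ae ?_
    filter_upwards [hf, Lp.coeFn_smul (((-κ ^ 2 : ℝ) : ℂ)) hH.memLp.toLp] with x h1 h2
    rw [h2, Pi.smul_apply, h1]
    simp

end Eigenvalues

/-! ### From eigenfunctions to zeros of the Jost function -/

section Regularity

variable {V : ℝ → ℝ} (hV : IntegrableOn (fun x : ℝ => (1 + x) * V x) (Ioi 0) volume)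

/-- A primitive of a square integrable function supported in `[0, X]` which vanishes beyond `X`
belongs to `H¹(ℝ₊)`. -/
theorem isH1_of_support {d : ℝ → ℂ} {X : ℝ} (hX : 0 ≤ X) (hd : MemLp d 2 halfLine)
    (hd0 : ∀ x, X < x → d x = 0) : IsH1 (fun x => -∫ t in Ioi x, d t) d := by
  have hdi : IntegrableOn d (Ioi 0) volume := by
    have h1 : MemLp d 2 (volume.restrict (Ioc 0 X)) :=
      hd.mono_measure (Measure.restrict_mono Ioc_subset_Ioi_self le_rfl)
    have h2 : IntegrableOn d (Ioc 0 X) volume := h1.integrable (by norm_num)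
    rw [← Ioc_union_Ioi_eq_Ioi hX]
    refine h2.union ((integrableOn_zero).congr_fun (fun x hx => ?_) measurableSet_Ioi)
    exact (hd0 x hx).symm
  have hp := (isPrim_integral_Ioi hdi).const_mul (-1)
  have hp' : IsPrim (fun x => -∫ t in Ioi x, d t) d :=
    hp.congr (fun x _ => by ring) (Eventually.of_forall fun x _ => by ring)
  refine ⟨?_, hd, hp'.eq_integral⟩
  have hz : ∀ x, X < x → -∫ t in Ioi x, d t = 0 := fun x hx => by
    rw [setIntegral_eq_zero_of_forall_eq_zero, neg_zero]
    exact fun t ht => hd0 t (hx.trans ht)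
  obtain ⟨C, hC⟩ := isCompact_Icc.exists_bound_of_continuousOn
    (hp'.continuousOn.mono (fun y (hy : y ∈ Icc 0 X) => hy.1))
  have hind : MemLp ((Ioc 0 X).indicator fun _ => C) 2 halfLine :=
    memLp_indicator_const 2 measurableSet_Ioc C (Or.inr (by
      refine ((Measure.restrict_apply_le _ _).trans_lt ?_).ne
      simp))
  refine hind.mono ((hp'.continuousOn.mono Ioi_subset_Ici_self).aestronglyMeasurable
    measurableSet_Ioi) ?_
  filter_upwards [ae_restrict_mem measurableSet_Ioi] with x hx
  by_cases hxX : x ≤ X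
  · rw [indicator_of_mem (show x ∈ Ioc 0 X from ⟨hx, hxX⟩)]
    exact (hC x ⟨(mem_Ioi.1 hx).le, hxX⟩).trans (le_abs_self _)
  · rw [hz x (not_le.1 hxX), norm_zero]
    exact norm_nonneg _

include hV

/-- Elements of the operator domain are genuine solutions: if `u ∈ H¹` satisfies the weak eigenvalue
equation, then `u'` agrees almost everywhere with the primitive `P` of `(V - λ) u` starting from
`γ u(0)`. The test functions are the primitives of `u' - P` cut off at a finite point. -/
theorem weak_solution_deriv_eq {γ lam : ℝ} {u u' : ℝ → ℂ} (hu : IsH1 u u')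
    (hform : ∀ v v' : ℝ → ℂ, IsH1 v v' →
      robinForm V γ u u' v v' = ∫ x in Ioi (0 : ℝ), (lam : ℂ) * u x * conj (v x))
    {P : ℝ → ℂ} (hP : IsPrim P (fun x => ((V x : ℂ) - lam) * u x)) (hP0 : P 0 = γ * u 0) :
    ∀ᵐ x ∂halfLine, u' x = P x := by
  suffices hX : ∀ n : ℕ, ∀ᵐ x ∂(volume.restrict (Ioc (0 : ℝ) n)), u' x = P x by
    have h1 : ∀ n : ℕ, ∀ᵐ x ∂volume, x ∈ Ioc (0 : ℝ) n → u' x = P x := fun n =>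
      (ae_restrict_iff' measurableSet_Ioc).1 (hX n)
    rw [ae_restrict_iff' measurableSet_Ioi]
    filter_upwards [ae_all_iff.2 h1] with x hx hx0
    obtain ⟨n, hn⟩ := exists_nat_ge x
    exact hx n ⟨hx0, hn⟩
  intro n
  have hn : (0 : ℝ) ≤ n := n.cast_nonneg
  generalize (n : ℝ) = X at hn ⊢
  have hPX : MemLp ((Ioc 0 X).indicator P) 2 halfLine := by
    obtain ⟨C, hC⟩ := isCompact_Icc.exists_bound_of_continuousOn
      (hP.continuousOn.mono (fun y (hy : y ∈ Icc 0 X) => hy.1))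
    have hind : MemLp ((Ioc 0 X).indicator fun _ => C) 2 halfLine :=
      memLp_indicator_const 2 measurableSet_Ioc C (Or.inr (by
        refine ((Measure.restrict_apply_le _ _).trans_lt ?_).ne
        simp))
    refine hind.mono (((hP.continuousOn.mono Ioi_subset_Ici_self).aestronglyMeasurable
      measurableSet_Ioi).indicator measurableSet_Ioc) (Eventually.of_forall fun x => ?_)
    by_cases hx : x ∈ Ioc 0 X
    · rw [indicator_of_mem hx, indicator_of_mem hx]
      exact (hC x ⟨hx.1.le, hx.2⟩).trans (le_abs_self _)
    · rw [indicator_of_notMem hx, indicator_of_notMem hx, norm_zero, norm_zero]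
  set d : ℝ → ℂ := (Ioc 0 X).indicator (fun x => u' x - P x) with hd
  have hdL : MemLp d 2 halfLine := by
    have : d = (Ioc 0 X).indicator u' - (Ioc 0 X).indicator P := indicator_sub _ _ _
    rw [this]
    exact (hu.memLp_deriv.indicator measurableSet_Ioc).sub hPX
  have hd0 : ∀ x, X < x → d x = 0 := fun x hx => indicator_of_notMem (fun h => not_lt.2 h.2 hx) _
  have hv := isH1_of_support hn hdL hd0
  set v : ℝ → ℂ := fun x => -∫ t in Ioi x, d t with hvdef
  have hvz : ∀ x, X ≤ x → v x = 0 := fun x hx => by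
    simp only [hvdef]
    rw [setIntegral_eq_zero_of_forall_eq_zero, neg_zero]
    exact fun t ht => hd0 t (lt_of_le_of_lt hx ht)
  obtain ⟨C, hC⟩ := hu.exists_bound
  obtain ⟨D, hD⟩ := hv.exists_bound
  have i1 : IntegrableOn (fun x => u' x * conj (d x)) (Ioi 0) volume :=
    integrable_mul_of_memLp_two hu.memLp_deriv (memLp_conj hdL)
  have i2 := integrableOn_potential_mul_mul hV hu.isPrim.continuousOn hv.isPrim.continuousOn hC hD
  have i3 : IntegrableOn (fun x => u x * conj (v x)) (Ioi 0) volume :=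
    integrable_mul_of_memLp_two hu.memLp (memLp_conj hv.memLp)
  have i4 : IntegrableOn (fun x => (lam : ℂ) * u x * conj (v x)) (Ioi 0) volume := by
    simpa only [mul_assoc, IntegrableOn] using i3.const_mul (lam : ℂ)
  have hf := hform v d hv
  rw [robinForm] at hf
  have hcut : ∀ F : ℝ → ℂ, (∀ x, X < x → F x = 0) →
      ∫ x in Ioi (0 : ℝ), F x = ∫ x in (0 : ℝ)..X, F x := fun F hF => by
    rw [intervalIntegral.integral_of_le hn]
    refine setIntegral_eq_of_subset_of_forall_sdiff_eq_zero measurableSet_Ioi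
      Ioc_subset_Ioi_self fun x hx => hF x ?_
    by_contra h
    exact hx.2 ⟨hx.1, not_lt.1 h⟩
  rw [hcut _ (fun x hx => by rw [hd0 x hx, hvz x hx.le]; simp),
    hcut _ (fun x hx => by rw [hvz x hx.le]; simp)] at hf
  have hp := (hP.mul hv.isPrim.conjugate).eq_integral X hn
  rw [hvz X le_rfl, map_zero, mul_zero, hP0] at hp
  have hsub : ∀ {F : ℝ → ℂ}, IntegrableOn F (Ioi 0) volume → IntervalIntegrable F volume 0 X :=
    fun hF => (intervalIntegrable_iff_integrableOn_Ioc_of_le hn).2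
      (hF.mono_set Ioc_subset_Ioi_self)
  have hi12 : IntervalIntegrable (fun x => u' x * conj (d x) + V x * u x * conj (v x)) volume 0 X :=
    hsub (i1.add i2)
  have hi4 := hsub i4
  have hip := (hP.mul hv.isPrim.conjugate).integrable X hn
  have hkey : ∫ x in (0 : ℝ)..X, ((‖d x‖ ^ 2 : ℝ) : ℂ) = 0 := by
    have h1 : ∀ᵐ x : ℝ, x ∈ uIoc 0 X → ((‖d x‖ ^ 2 : ℝ) : ℂ) =
        (u' x * conj (d x) + V x * u x * conj (v x)) - lam * u x * conj (v x) -
          (((V x : ℂ) - lam) * u x * conj (v x) + P x * conj (d x)) := by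
      refine Eventually.of_forall fun x hx => ?_
      rw [uIoc_of_le hn] at hx
      have h2 : ((‖d x‖ ^ 2 : ℝ) : ℂ) = (u' x - P x) * conj (d x) := by
        rw [← Complex.normSq_eq_norm_sq, ← Complex.mul_conj]
        congr 1
        exact indicator_of_mem hx _
      rw [h2]
      ring
    rw [intervalIntegral.integral_congr_ae h1, intervalIntegral.integral_sub (hi12.sub hi4) hip,
      intervalIntegral.integral_sub hi12 hi4]
    linear_combination hf + hp
  rw [intervalIntegral.integral_ofReal, Complex.ofReal_eq_zero,
    intervalIntegral.integral_of_le hn] at hkey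
  have hdi : IntegrableOn (fun x => ‖d x‖ ^ 2) (Ioc 0 X) volume :=
    IntegrableOn.mono_set (hdL.integrable_norm_pow (by norm_num)) Ioc_subset_Ioi_self
  have h3 := (setIntegral_eq_zero_iff_of_nonneg_ae
    (Eventually.of_forall fun x => by positivity) hdi).1 hkey
  filter_upwards [h3, ae_restrict_mem measurableSet_Ioc] with x hx hx'
  have h4 : d x = 0 := by simpa using hx
  rw [hd, indicator_of_mem hx'] at h4
  exact sub_eq_zero.1 h4

/-- An eigenfunction for a negative eigenvalue is a multiple of the corresponding Jost solution,
because their Wronskian is constant and integrable; hence the Jost solution satisfies the boundary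
condition. -/
theorem IsEigenvector.eq_jostSolution {γ κ : ℝ} (hκ : 0 < κ) {f : L2}
    (hf : IsEigenvector V γ (-κ ^ 2) f) : jostFunction V γ (Complex.I * κ) = 0 ∧
      ∃ c : ℂ, c ≠ 0 ∧ (f : ℝ → ℂ) =ᵐ[halfLine] fun x => c * (jostSolution V (Complex.I * κ)).1 x := by
  obtain ⟨hf0, u, u', hu, hfu, hform⟩ := hf
  have him : 0 < (Complex.I * (κ : ℂ)).im := by simpa using hκ
  have hJ := isJostSolution_jostSolution hV him.le
  have hH := isH1_jostSolution hV him
  have hform' : ∀ v v' : ℝ → ℂ, IsH1 v v' →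
      robinForm V γ u u' v v' = ∫ x in Ioi (0 : ℝ), ((-κ ^ 2 : ℝ) : ℂ) * u x * conj (v x) := by
    intro v v' hv
    rw [hform v v' hv]
    refine integral_congr_ae ?_
    filter_upwards [hfu, Lp.coeFn_smul (((-κ ^ 2 : ℝ) : ℂ)) f] with x h1 h2
    rw [h2, Pi.smul_apply, h1, smul_eq_mul]
  set P : ℝ → ℂ := fun x => γ * u 0 + ∫ t in (0 : ℝ)..x, ((V t : ℂ) - (-κ ^ 2 : ℝ)) * u t with hPdef
  have hP0 : P 0 = γ * u 0 := by simp [hPdef]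
  have hP : IsPrim P (fun x => ((V x : ℂ) - (-κ ^ 2 : ℝ)) * u x) := by
    refine ⟨fun x hx => (intervalIntegrable_potential_sub hV _ hx).mul_continuousOn
      (hu.isPrim.continuousOn.mono (by rw [uIcc_of_le hx]; exact Icc_subset_Ici_self)),
      fun x _ => by rw [hP0]⟩
  have hae := weak_solution_deriv_eq hV hu hform' hP hP0
  have hprim : IsPrim u P := hu.isPrim.congr (fun _ _ => rfl)
    ((ae_restrict_iff' measurableSet_Ioi).1 hae)
  have hsol : IsSolution V (Complex.I * κ) u P := by
    refine ⟨fun x hx => ?_, fun x hx => ?_⟩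
    · have hPc := hP.continuousOn
      have h1 : HasDerivWithinAt (fun y => ∫ t in (0 : ℝ)..y, P t) (P x) (Ici 0) x := by
        have hPe : Continuous fun t => P (max t 0) := by
          rw [← continuousOn_univ]
          exact hPc.comp (by fun_prop) fun t _ => le_max_right t 0
        have h2 := (hPe.integral_hasStrictDerivAt 0 x).hasDerivAt.hasDerivWithinAt (s := Ici 0)
        rw [max_eq_left hx] at h2
        have h3 : ∀ y : ℝ, 0 ≤ y → ∫ t in (0 : ℝ)..y, P t = ∫ t in (0 : ℝ)..y, P (max t 0) :=
          fun y hy => intervalIntegral.integral_congr fun t ht => by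
            rw [uIcc_of_le hy] at ht
            simp only [max_eq_left ht.1]
        exact h2.congr (fun y hy => h3 y hy) (h3 x hx)
      exact (h1.const_add (u 0)).congr (fun y hy => hprim.eq_integral y hy) (hprim.eq_integral x hx)
    · rw [hP.eq_integral x hx]
      simp [mul_pow]
  have hPL : MemLp P 2 halfLine := hu.memLp_deriv.ae_eq hae
  have hWi : IntegrableOn (wronskian u P (jostSolution V (Complex.I * κ)).1
      (jostSolution V (Complex.I * κ)).2) (Ioi 0) volume :=
    (integrable_mul_of_memLp_two hu.memLp hH.memLp_deriv).sub
      (integrable_mul_of_memLp_two hPL hH.memLp)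
  have hW0 : wronskian u P (jostSolution V (Complex.I * κ)).1
      (jostSolution V (Complex.I * κ)).2 0 = 0 := by
    have h1 : IntegrableOn (fun _ : ℝ => wronskian u P (jostSolution V (Complex.I * κ)).1
      (jostSolution V (Complex.I * κ)).2 0) (Ioi 0) volume :=
      hWi.congr_fun (fun x hx => hsol.wronskian_const hV hJ.isSolution rfl (mem_Ioi.1 hx).le)
        measurableSet_Ioi
    rw [integrableOn_const_iff] at h1
    simpa using h1
  obtain ⟨c, hc⟩ := hsol.exists_eq_const_mul hV hJ.isSolution hW0 (hJ.not_trivial hV)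
  have hfc : (f : ℝ → ℂ) =ᵐ[halfLine] fun x => c * (jostSolution V (Complex.I * κ)).1 x := by
    filter_upwards [hfu, ae_restrict_mem measurableSet_Ioi] with x h1 h2
    rw [h1, (hc x (mem_Ioi.1 h2).le).1]
  have hc0 : c ≠ 0 := by
    rintro rfl
    refine hf0 (Lp.ext ?_)
    filter_upwards [hfc, Lp.coeFn_zero ℂ 2 halfLine] with x h1 h2
    rw [h1, h2]; simp
  refine ⟨?_, c, hc0, hfc⟩
  have h1 := (hc 0 le_rfl).1
  have h2 := (hc 0 le_rfl).2
  rw [hP0, h1] at h2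
  refine (mul_eq_zero.1 (?_ : c * jostFunction V γ (Complex.I * κ) = 0)).resolve_left hc0
  rw [jostFunction]
  linear_combination h2

/-- The negative eigenvalues are the numbers `-κ²` with `κ > 0` and `w(iκ) = 0`. -/
theorem negEigenvalues_eq (γ : ℝ) : negEigenvalues V γ =
    (fun κ : ℝ => -κ ^ 2) '' {κ : ℝ | 0 < κ ∧ jostFunction V γ (Complex.I * κ) = 0} := by
  ext lam
  constructor
  · rintro ⟨hlam, f, hf⟩
    have hκ : 0 < Real.sqrt (-lam) := Real.sqrt_pos.2 (by linarith)
    have hsq : -Real.sqrt (-lam) ^ 2 = lam := by rw [Real.sq_sqrt (by linarith)]; ring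
    rw [← hsq] at hf
    exact ⟨_, ⟨hκ, (hf.eq_jostSolution hV hκ).1⟩, hsq⟩
  · rintro ⟨κ, ⟨hκ, hw⟩, rfl⟩
    exact ⟨by simp only; nlinarith [pow_pos hκ 2], exists_isEigenvector hV hκ hw⟩

/-- Negative eigenvalues are simple. -/
theorem exists_smul_eq_of_mem_negEigenvalues {γ lam : ℝ} (hlam : lam < 0) {f g : L2}
    (hf : IsEigenvector V γ lam f) (hg : IsEigenvector V γ lam g) : ∃ c : ℂ, g = c • f := by
  have hκ : 0 < Real.sqrt (-lam) := Real.sqrt_pos.2 (by linarith)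
  have hsq : -Real.sqrt (-lam) ^ 2 = lam := by rw [Real.sq_sqrt (by linarith)]; ring
  rw [← hsq] at hf hg
  obtain ⟨-, a, ha, hfa⟩ := hf.eq_jostSolution hV hκ
  obtain ⟨-, b, -, hgb⟩ := hg.eq_jostSolution hV hκ
  refine ⟨b / a, Lp.ext ?_⟩
  filter_upwards [hfa, hgb, Lp.coeFn_smul (b / a) f] with x h1 h2 h3
  rw [h3, Pi.smul_apply, h1, h2, smul_eq_mul]
  field_simp

end Regularity

/-! ### Continuous arguments of functions on the closed upper half-plane -/

/-- A continuous function with finitely many zeros, all of them simple, is a product of linear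
factors and a continuous function without zeros. -/
theorem exists_factorization {X : Type*} [TopologicalSpace X] [T1Space X] {e : X → ℂ}
    (he : Continuous e) (hinj : Function.Injective e) (Z : Finset X) :
    ∀ F : X → ℂ, Continuous F → (∀ x, F x = 0 ↔ x ∈ Z) →
      (∀ z ∈ Z, ∃ c : ℂ, c ≠ 0 ∧ Tendsto (fun x => F x / (e x - e z)) (𝓝[≠] z) (𝓝 c)) →
      ∃ G : X → ℂ, Continuous G ∧ (∀ x, G x ≠ 0) ∧ ∀ x, F x = G x * ∏ z ∈ Z, (e x - e z) := by
  classical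
  induction Z using Finset.induction_on with
  | empty => exact fun F hF h0 _ => ⟨F, hF, fun x hx => by simpa using (h0 x).1 hx, by simp⟩
  | insert a s ha ih =>
    intro F hF h0 hd
    obtain ⟨c, hc, hlim⟩ := hd a (Finset.mem_insert_self a s)
    have hFa : F a = 0 := (h0 a).2 (Finset.mem_insert_self a s)
    have hne : ∀ x, x ≠ a → e x - e a ≠ 0 := fun x hx => sub_ne_zero.2 fun h => hx (hinj h)
    set F₁ : X → ℂ := Function.update (fun x => F x / (e x - e a)) a c with hF₁
    have hF₁a : F₁ a = c := Function.update_self ..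
    have hF₁x : ∀ x, x ≠ a → F₁ x = F x / (e x - e a) := fun x hx => Function.update_of_ne hx ..
    have hcont : Continuous F₁ := by
      rw [continuous_iff_continuousAt]
      intro x
      by_cases hx : x = a
      · rw [hx, hF₁, continuousAt_update_same]
        exact hlim
      · rw [hF₁, continuousAt_update_of_ne hx]
        exact hF.continuousAt.div (by fun_prop) (hne x hx)
    have hzero : ∀ x, F₁ x = 0 ↔ x ∈ s := fun x => by
      by_cases hx : x = a
      · rw [hx, hF₁a]; exact iff_of_false hc ha
      · rw [hF₁x x hx, div_eq_zero_iff, or_iff_left (hne x hx), h0, Finset.mem_insert,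
          or_iff_right hx]
    have hdiv : ∀ z ∈ s, ∃ c : ℂ, c ≠ 0 ∧
        Tendsto (fun x => F₁ x / (e x - e z)) (𝓝[≠] z) (𝓝 c) := fun z hz => by
      have hza : z ≠ a := fun h => ha (h ▸ hz)
      obtain ⟨b, hb, hlimz⟩ := hd z (Finset.mem_insert_of_mem hz)
      refine ⟨b / (e z - e a), div_ne_zero hb (hne z hza), ?_⟩
      have h1 : Tendsto (fun x => e x - e a) (𝓝[≠] z) (𝓝 (e z - e a)) :=
        ((he.sub continuous_const).tendsto z).mono_left nhdsWithin_le_nhds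
      refine (hlimz.div h1 (hne z hza)).congr' ?_
      filter_upwards [nhdsWithin_le_nhds (isOpen_ne.mem_nhds hza)] with x hx
      rw [Pi.div_apply, hF₁x x hx]
      ring
    obtain ⟨G, hG, hG0, hGF⟩ := ih F₁ hcont hzero hdiv
    refine ⟨G, hG, hG0, fun x => ?_⟩
    rw [Finset.prod_insert ha]
    by_cases hx : x = a
    · rw [hx, hFa, sub_self]; ring
    · have := hGF x
      rw [hF₁x x hx, div_eq_iff (hne x hx)] at this
      rw [this]; ring

/-- A continuous function with values in `2πℤ` is constant. -/
theorem eq_of_exp_eq_one {S : Set ℝ} (hS : IsPreconnected S) {h : ℝ → ℝ} (hc : ContinuousOn h S)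
    (h1 : ∀ s ∈ S, Complex.exp (Complex.I * h s) = 1) : ∀ s ∈ S, ∀ t ∈ S, h s = h t := by
  have key : ∀ s ∈ S, ∀ t ∈ S, ¬ h s < h t := by
    intro s hs t ht hlt
    have hint : ∀ r ∈ S, ∃ n : ℤ, h r = n * (2 * Real.pi) := fun r hr => by
      obtain ⟨n, hn⟩ := Complex.exp_eq_one_iff.1 (h1 r hr)
      refine ⟨n, ?_⟩
      have h2 : Complex.I * (h r : ℂ) = Complex.I * ((n * (2 * Real.pi) : ℝ) : ℂ) := by
        rw [hn]; push_cast; ring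
      exact Complex.ofReal_injective (mul_left_cancel₀ Complex.I_ne_zero h2)
    obtain ⟨m, hm⟩ := hint s hs
    obtain ⟨n, hn⟩ := hint t ht
    have hpi := Real.pi_pos
    have hmn : m + 1 ≤ n := by
      rw [hm, hn] at hlt
      have : (m : ℝ) < n := lt_of_mul_lt_mul_right hlt (by positivity)
      exact_mod_cast this
    have hmn' : (m : ℝ) + 1 ≤ n := by exact_mod_cast hmn
    -- The value halfway between consecutive points of `2πℤ` is attained, but excluded.
    obtain ⟨r, hr, hrv⟩ := hS.intermediate_value hs ht hc
      (show h s + Real.pi ∈ Icc (h s) (h t) from ⟨by linarith, by rw [hm, hn]; nlinarith⟩)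
    have h3 := h1 r hr
    rw [hrv, Complex.ofReal_add, mul_add, Complex.exp_add, h1 s hs, one_mul, mul_comm,
      Complex.exp_pi_mul_I] at h3
    norm_num at h3
  exact fun s hs t ht => le_antisymm (not_lt.1 (key t ht s hs)) (not_lt.1 (key s hs t ht))

/-- The retraction `x + iy ↦ x + i|y|` of the plane onto the closed upper half-plane. It makes functions
on the half-plane functions on the simply connected space `ℂ`. -/
def foldUpper (z : ℂ) : ClosedUpper := ⟨z.re + |z.im| * Complex.I, by simp⟩

theorem continuous_foldUpper : Continuous foldUpper := by
  unfold foldUpper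
  have h : Continuous fun z : ℂ => (z.re : ℂ) + ((|z.im| : ℝ) : ℂ) * Complex.I := by fun_prop
  exact h.subtype_mk _

theorem foldUpper_of_nonneg {z : ℂ} (hz : 0 ≤ z.im) : foldUpper z = ⟨z, hz⟩ := by
  apply Subtype.ext
  simp only [foldUpper, abs_of_nonneg hz, Complex.re_add_im]

/-- The point `k` of the real axis. -/
def realPoint (k : ℝ) : ClosedUpper := ⟨k, by simp⟩

/-- The point `i|τ|` of the imaginary axis. -/
def imagPoint (τ : ℝ) : ClosedUpper := ⟨Complex.I * (|τ| : ℝ), by simp⟩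

/-- The argument principle in the form needed here. If `g` has no zeros in the closed upper
half-plane, tends to `1` at infinity and is real on the imaginary axis, then the argument of `g` has
the same limit at both ends of the positive real axis: along the imaginary axis it is constant,
and on a large quarter circle it is close to a multiple of `2π`. -/
theorem exists_phase_tendsto_zero {g : ClosedUpper → ℂ} (hg : Continuous g) (hg0 : ∀ ζ, g ζ ≠ 0)
    (hlim : Tendsto g (comap (fun ζ : ClosedUpper => ‖(ζ : ℂ)‖) atTop) (𝓝 1))
    (hreal : ∀ τ : ℝ, conj (g (imagPoint τ)) = g (imagPoint τ)) :
    ∃ ψ : ℝ → ℝ, Continuous ψ ∧ (∀ k : ℝ, g (realPoint k) =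
      ‖g (realPoint k)‖ * Complex.exp (Complex.I * ψ k)) ∧
      Tendsto ψ (𝓝[>] 0) (𝓝 0) ∧ Tendsto ψ atTop (𝓝 0) := by
  obtain ⟨L, hLc, hL⟩ := Complex.exists_continuousOn_eqOn_exp_comp
    (X := ℂ) (U := univ) (g := g ∘ foldUpper)
    (have := (convex_univ (𝕜 := ℝ) (E := ℂ)).contractibleSpace univ_nonempty
     (inferInstance : SimplyConnectedSpace (univ : Set ℂ))) isOpen_univ
    (hg.comp continuous_foldUpper).continuousOn (by
      rintro ⟨z, -, hz⟩
      exact hg0 _ hz)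
  rw [continuousOn_univ] at hLc
  have hL' : ∀ z : ℂ, Complex.exp (L z) = g (foldUpper z) := fun z => hL (mem_univ z)
  have hpolar : ∀ z : ℂ, g (foldUpper z) =
      ‖g (foldUpper z)‖ * Complex.exp (Complex.I * (L z).im) := fun z => by
    rw [← hL', Complex.norm_exp, Complex.ofReal_exp, ← Complex.exp_add]
    congr 1
    rw [mul_comm, Complex.re_add_im]
  have hfi : ∀ τ : ℝ, foldUpper (Complex.I * τ) = imagPoint τ := fun τ => by
    apply Subtype.ext
    simp [foldUpper, imagPoint, mul_comm]
  have hfr : ∀ k : ℝ, foldUpper k = realPoint k := fun k => foldUpper_of_nonneg (by simp)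
  have hLim : Continuous fun z => (L z).im := Complex.continuous_im.comp hLc
  -- Along the imaginary axis `g` is real, so twice its argument is a multiple of `2π`.
  have hconst : ∀ τ : ℝ, (L (Complex.I * τ)).im = (L 0).im := by
    intro τ
    have h1 := eq_of_exp_eq_one isPreconnected_univ
      (h := fun τ : ℝ => 2 * (L (Complex.I * τ)).im)
      (by rw [continuousOn_univ]; exact continuous_const.mul (hLim.comp (by fun_prop)))
      (fun τ _ => by
        have h2 := hpolar (Complex.I * τ)
        rw [hfi] at h2
        have h3 := hreal τ
        rw [h2, map_mul, ← Complex.exp_conj, map_mul, Complex.conj_I, Complex.conj_ofReal,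
          Complex.conj_ofReal] at h3
        have h4 := mul_left_cancel₀
          (Complex.ofReal_ne_zero.2 (norm_ne_zero_iff.2 (hg0 (imagPoint τ)))) h3
        push_cast
        rw [show Complex.I * (2 * ((L (Complex.I * τ)).im : ℂ)) =
          Complex.I * (L (Complex.I * τ)).im - -Complex.I * (L (Complex.I * τ)).im by ring,
          Complex.exp_sub, h4, div_self (Complex.exp_ne_zero _)])
      τ (mem_univ _) 0 (mem_univ _)
    simpa using h1
  -- Far away `g` is close to `1`, hence in the domain of the principal argument.
  have hev : ∀ᶠ R : ℝ in atTop, ∀ ζ : ClosedUpper, ‖(ζ : ℂ)‖ = R → ‖g ζ - 1‖ < 1 := by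
    have h1 := hlim.eventually (Metric.ball_mem_nhds (1 : ℂ) one_pos)
    obtain ⟨T, hT, hT'⟩ := Filter.eventually_comap.1 h1 |>.exists_mem
    filter_upwards [hT] with R hR ζ hζ
    have := hT' R hR ζ hζ
    rwa [dist_eq_norm] at this
  have hre : ∀ z : ℂ, ‖z - 1‖ < 1 → 0 < z.re := fun z hz => by
    have h1 := (Complex.abs_re_le_norm (z - 1)).trans_lt hz
    rw [Complex.sub_re, Complex.one_re, abs_lt] at h1
    linarith
  have hfar : ∀ᶠ R : ℝ in atTop, (L R).im = (L 0).im + Complex.arg (g (realPoint R)) ∧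
      Complex.exp (Complex.I * (L 0).im) = 1 := by
    filter_upwards [hev, eventually_gt_atTop 0] with R hR hR0
    set arc : ℝ → ℂ := fun t => R * Complex.exp (Complex.I * t) with harc
    have harcc : Continuous arc := by fun_prop
    have hnorm : ∀ t ∈ Icc (0 : ℝ) (Real.pi / 2), ‖(foldUpper (arc t) : ℂ)‖ = R := by
      intro t ht
      have him : 0 ≤ (arc t).im := by
        have h1 := Real.sin_nonneg_of_nonneg_of_le_pi ht.1 (by linarith [ht.2, Real.pi_pos])
        have h2 : (arc t).im = R * Real.sin t := by
          simp [harc, mul_comm Complex.I, Complex.exp_ofReal_mul_I_im]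
        rw [h2]; positivity
      rw [foldUpper_of_nonneg him]
      simp [harc, mul_comm Complex.I, Complex.norm_exp_ofReal_mul_I, abs_of_pos hR0]
    have hclose := fun t ht => hre _ (hR _ (hnorm t ht))
    have h1 := eq_of_exp_eq_one (S := Icc 0 (Real.pi / 2)) isPreconnected_Icc
      (h := fun t => (L (arc t)).im - Complex.arg (g (foldUpper (arc t)))) ?_ ?_
      0 ⟨le_rfl, by positivity⟩ (Real.pi / 2) ⟨by positivity, le_rfl⟩
    · have h2 : arc 0 = R := by simp [harc]
      have h3 : arc (Real.pi / 2) = Complex.I * R := by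
        simp only [harc]
        push_cast
        rw [mul_comm Complex.I, Complex.exp_pi_div_two_mul_I, mul_comm]
      have h4 := hclose (Real.pi / 2) ⟨by positivity, le_rfl⟩
      rw [h3, hfi] at h4
      have h5 : g (imagPoint R) = ((g (imagPoint R)).re : ℂ) :=
        (Complex.conj_eq_iff_real.1 (hreal R)).elim fun r hr => by rw [hr]; simp
      have h6 : Complex.arg (g (imagPoint R)) = 0 := by
        rw [h5]; exact Complex.arg_ofReal_of_nonneg h4.le
      simp only [h2, h3, hfi, hfr, h6, hconst] at h1
      refine ⟨by linarith, ?_⟩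
      have h7 := hpolar (Complex.I * R)
      rw [hfi, hconst, h5, Complex.norm_real, Real.norm_eq_abs, abs_of_pos h4] at h7
      exact (mul_left_cancel₀ (Complex.ofReal_ne_zero.2 h4.ne') (by rw [← h7, mul_one])).symm
    · refine (hLim.comp harcc).continuousOn.sub fun t ht => ?_
      exact ((Complex.continuousAt_arg (Or.inl (hclose t ht))).comp
        (f := fun t => g (foldUpper (arc t)))
        ((hg.comp (continuous_foldUpper.comp harcc)).continuousAt)).continuousWithinAt
    · intro t _
      have h2 := hpolar (arc t)
      have h3 := Complex.norm_mul_exp_arg_mul_I (g (foldUpper (arc t)))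
      have h4 := h3.trans h2
      have h5 := mul_left_cancel₀
        (Complex.ofReal_ne_zero.2 (norm_ne_zero_iff.2 (hg0 (foldUpper (arc t))))) h4
      rw [Complex.ofReal_sub, mul_sub, Complex.exp_sub, ← h5, mul_comm Complex.I,
        div_self (Complex.exp_ne_zero _)]
  obtain ⟨-, -, hone⟩ := hfar.exists
  refine ⟨fun k => (L k).im - (L 0).im, (hLim.comp Complex.continuous_ofReal).sub continuous_const,
    fun k => ?_, ?_, ?_⟩
  · have h1 := hpolar k
    rw [hfr] at h1
    rw [Complex.ofReal_sub, mul_sub, Complex.exp_sub, hone, div_one]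
    exact h1
  · have h1 : Continuous fun k : ℝ => (L k).im - (L 0).im :=
      (hLim.comp Complex.continuous_ofReal).sub continuous_const
    have h2 := (h1.tendsto 0).mono_left (nhdsWithin_le_nhds (s := Ioi 0))
    simpa using h2
  · have h1 : Tendsto (fun R : ℝ => Complex.arg (g (realPoint R))) atTop (𝓝 0) := by
      have h2 : Tendsto realPoint atTop (comap (fun ζ : ClosedUpper => ‖(ζ : ℂ)‖) atTop) := by
        rw [tendsto_comap_iff]
        refine tendsto_abs_atTop_atTop.congr fun R => ?_
        simp [realPoint]
      have h3 := (Complex.continuousAt_arg (x := 1) (by simp)).tendsto.comp (hlim.comp h2)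
      rwa [Complex.arg_one] at h3
    refine h1.congr' ?_
    filter_upwards [hfar] with R hR
    rw [hR.1]; ring

/-! ### Factorization of the Jost function -/

/-- `φ` is an argument of `z`. -/
def IsArg (z : ℂ) (φ : ℝ) : Prop := z = ‖z‖ * Complex.exp (Complex.I * φ)

section Arg

variable {z z₁ z₂ : ℂ} {φ φ₁ φ₂ : ℝ}

theorem IsArg.mul (h₁ : IsArg z₁ φ₁) (h₂ : IsArg z₂ φ₂) : IsArg (z₁ * z₂) (φ₁ + φ₂) := by
  unfold IsArg at *
  rw [norm_mul, Complex.ofReal_add, mul_add, Complex.exp_add]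
  nth_rw 1 [h₁, h₂]
  push_cast; ring

theorem IsArg.div (h₁ : IsArg z₁ φ₁) (h₂ : IsArg z₂ φ₂) : IsArg (z₁ / z₂) (φ₁ - φ₂) := by
  unfold IsArg at *
  rw [norm_div, Complex.ofReal_sub, mul_sub, Complex.exp_sub]
  nth_rw 1 [h₁, h₂]
  push_cast
  rw [mul_div_mul_comm]

theorem IsArg.prod {ι : Type*} (s : Finset ι) {z : ι → ℂ} {φ : ι → ℝ}
    (h : ∀ i ∈ s, IsArg (z i) (φ i)) : IsArg (∏ i ∈ s, z i) (∑ i ∈ s, φ i) := by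
  classical
  induction s using Finset.induction_on with
  | empty => simp [IsArg]
  | insert a s ha ih =>
    rw [Finset.prod_insert ha, Finset.sum_insert ha]
    exact (h a (Finset.mem_insert_self a s)).mul
      (ih fun i hi => h i (Finset.mem_insert_of_mem hi))

theorem isArg_add_mul_I {k : ℝ} (hk : 0 < k) (c : ℝ) :
    IsArg (k + Complex.I * c) (Real.arctan (c / k)) := by
  have h1 : Complex.arg (k + Complex.I * c) = Real.arctan (c / k) := by
    rw [Complex.arg_of_re_nonneg (by simpa using hk.le), Real.arctan_eq_arcsin]
    congr 1
    have h2 : ‖(k + Complex.I * c : ℂ)‖ = k * Real.sqrt (1 + (c / k) ^ 2) := by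
      rw [← Real.sqrt_sq hk.le, ← Real.sqrt_mul (by positivity), Complex.norm_def,
        Complex.normSq_apply]
      congr 1
      simp [Real.sqrt_sq hk.le]
      field_simp
    rw [h2]
    simp
    field_simp
  rw [IsArg, ← h1]
  nth_rw 4 [mul_comm]
  rw [Complex.norm_mul_exp_arg_mul_I]

end Arg

theorem tendsto_arctan_div_atTop (c : ℝ) :
    Tendsto (fun k : ℝ => Real.arctan (c / k)) atTop (𝓝 0) := by
  have h := (Real.continuous_arctan.tendsto 0).comp (tendsto_id.const_div_atTop c)
  rwa [Real.arctan_zero] at h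

theorem tendsto_arctan_div_zero (c : ℝ) :
    Tendsto (fun k : ℝ => Real.arctan (c / k)) (𝓝[>] 0) (𝓝 (Real.pi / 2 * Real.sign c)) := by
  rcases lt_trichotomy c 0 with hc | rfl | hc
  · rw [Real.sign_of_neg hc, mul_neg_one]
    exact ((Real.tendsto_arctan_atBot).mono_right nhdsWithin_le_nhds).comp
      (tendsto_inv_nhdsGT_zero.const_mul_atTop_of_neg hc)
  · simp
  · rw [Real.sign_of_pos hc, mul_one]
    exact ((Real.tendsto_arctan_atTop).mono_right nhdsWithin_le_nhds).comp
      (tendsto_inv_nhdsGT_zero.const_mul_atTop hc)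

section ZeroSet

variable {V : ℝ → ℝ} (hV : IntegrableOn (fun x : ℝ => (1 + x) * V x) (Ioi 0) volume)
include hV

theorem eq_I_mul_of_jostFunction_eq_zero {γ : ℝ} {z : ClosedUpper} (h : jostFunction V γ z = 0) :
    (z : ℂ) = Complex.I * ((z : ℂ).im : ℝ) := by
  have hre : (z : ℂ).re = 0 := by_contra fun hre => jostFunction_ne_zero hV z.2 hre h
  apply Complex.ext <;> simp [hre]

/-- All zeros of the Jost function in the closed upper half-plane are simple. -/
theorem jostFunction_simple_zero {γ : ℝ} {z : ClosedUpper} (h : jostFunction V γ z = 0) :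
    ∃ c : ℂ, c ≠ 0 ∧ Tendsto (fun ζ : ClosedUpper => jostFunction V γ ζ / (ζ - z : ℂ)) (𝓝[≠] z)
      (𝓝 c) := by
  have hz := eq_I_mul_of_jostFunction_eq_zero hV h
  rcases z.2.eq_or_lt with h0 | h0
  · have hz0 : (z : ℂ) = 0 := by rw [hz, ← h0]; simp
    exact exists_tendsto_jostFunction_div_zero hV (hz0 ▸ h) z hz0
  · exact exists_tendsto_jostFunction_div hV h0 (hz ▸ h) z hz

theorem finite_zeros_jostFunction (γ : ℝ) :
    {z : ClosedUpper | jostFunction V γ z = 0}.Finite := by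
  by_contra hinf
  have hw := continuous_jostFunction hV γ
  have hev := (tendsto_jostFunction_div hV γ).eventually (isOpen_ne.mem_nhds one_ne_zero)
  obtain ⟨T, hT, hT'⟩ := (Filter.eventually_comap.1 hev).exists_mem
  obtain ⟨R, hR⟩ := mem_atTop_sets.1 hT
  have hK : IsCompact ((fun ζ : ClosedUpper => (ζ : ℂ)) ⁻¹' Metric.closedBall 0 R) := by
    refine (IsClosed.isClosedEmbedding_subtypeVal ?_).isCompact_preimage
      (isCompact_closedBall 0 R)
    exact isClosed_le continuous_const Complex.continuous_im
  obtain ⟨z, -, hz⟩ := Set.Infinite.exists_accPt_of_subset_isCompact hinf hK fun ζ hζ => by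
    have h0 : jostFunction V γ ζ = 0 := hζ
    by_contra hn
    have h1 : R < ‖(ζ : ℂ)‖ := by simpa using hn
    exact hT' _ (hR _ h1.le) ζ rfl (by rw [h0, zero_div])
  rw [accPt_iff_frequently_nhdsNE] at hz
  refine hz ?_
  by_cases h0 : jostFunction V γ z = 0
  · obtain ⟨c, hc, hlim⟩ := jostFunction_simple_zero hV h0
    filter_upwards [hlim.eventually (isOpen_ne.mem_nhds hc)] with ζ hζ h1
    have h2 : jostFunction V γ ζ = 0 := h1
    exact hζ (by rw [h2, zero_div])
  · filter_upwards [nhdsWithin_le_nhds (hw.continuousAt (isOpen_ne.mem_nhds h0))] with ζ hζ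
    exact hζ

/-- The zeros of the Jost function in the closed upper half-plane. -/
def jostZeros (γ : ℝ) : Finset ClosedUpper := (finite_zeros_jostFunction hV γ).toFinset

theorem mem_jostZeros {γ : ℝ} {z : ClosedUpper} :
    z ∈ jostZeros hV γ ↔ jostFunction V γ z = 0 := by
  simp [jostZeros]

omit hV in
theorem add_add_I_ne_zero (ζ z : ClosedUpper) : (ζ + z + Complex.I : ℂ) ≠ 0 := by
  intro h
  have h1 := congrArg Complex.im h
  simp only [Complex.add_im, Complex.I_im, Complex.zero_im] at h1
  linarith [ζ.2, z.2]

/-- The Jost function is the product of explicit factors, carrying its zeros and its growth, and of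
a function without zeros, close to `1` at infinity and real on the imaginary axis. The denominators
`ζ + i(κ + 1)`, for a zero `iκ`, do not vanish on the closed half-plane even when `κ = 0`. -/
theorem exists_jostFunction_eq_mul (γ : ℝ) : ∃ g : ClosedUpper → ℂ, Continuous g ∧
    (∀ ζ, g ζ ≠ 0) ∧ Tendsto g (comap (fun ζ : ClosedUpper => ‖(ζ : ℂ)‖) atTop) (𝓝 1) ∧
    (∀ τ : ℝ, conj (g (imagPoint τ)) = g (imagPoint τ)) ∧
    ∀ ζ : ClosedUpper, jostFunction V γ ζ = g ζ * ((1 - Complex.I * ζ) *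
      ∏ z ∈ jostZeros hV γ, (ζ - z : ℂ) / (ζ + z + Complex.I)) := by
  set Z := jostZeros hV γ with hZ
  obtain ⟨G, hG, hG0, hGF⟩ := exists_factorization (e := fun ζ : ClosedUpper => (ζ : ℂ))
    continuous_subtype_val Subtype.val_injective Z (fun ζ => jostFunction V γ ζ)
    (continuous_jostFunction hV γ) (fun x => (mem_jostZeros hV).symm)
    (fun z hz => jostFunction_simple_zero hV ((mem_jostZeros hV).1 hz))
  have h1 : ∀ ζ : ClosedUpper, (1 - Complex.I * ζ : ℂ) ≠ 0 := fun ζ => one_sub_I_mul_ne_zero ζ.2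
  have h2 : ∀ ζ : ClosedUpper, ∏ z ∈ Z, (ζ + z + Complex.I : ℂ) ≠ 0 := fun ζ =>
    Finset.prod_ne_zero_iff.2 fun z _ => add_add_I_ne_zero ζ z
  set g : ClosedUpper → ℂ := fun ζ =>
    G ζ * (∏ z ∈ Z, (ζ + z + Complex.I : ℂ)) / (1 - Complex.I * ζ) with hg
  have hgc : Continuous g := by
    refine Continuous.div (hG.mul (continuous_finsetProd _ fun z _ => ?_)) ?_ h1 <;> fun_prop
  have hgw : ∀ ζ : ClosedUpper, jostFunction V γ ζ = g ζ * ((1 - Complex.I * ζ) *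
      ∏ z ∈ Z, (ζ - z : ℂ) / (ζ + z + Complex.I)) := fun ζ => by
    rw [hGF ζ, Finset.prod_div_distrib]
    have h3 := h1 ζ
    have h4 := h2 ζ
    simp only [hg]
    generalize (1 - Complex.I * ζ : ℂ) = a at h3 ⊢
    field_simp
  have hne : ∀ ζ : ClosedUpper, ζ ∉ Z → ∏ z ∈ Z, (ζ - z : ℂ) ≠ 0 := fun ζ hζ =>
    Finset.prod_ne_zero_iff.2 fun z hz h => hζ (by rwa [Subtype.ext (sub_eq_zero.1 h)])
  have hgdiv : ∀ ζ : ClosedUpper, ζ ∉ Z → g ζ = jostFunction V γ ζ / (1 - Complex.I * ζ) *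
      ∏ z ∈ Z, (ζ + z + Complex.I : ℂ) / (ζ - z) := fun ζ hζ => by
    rw [hGF ζ, Finset.prod_div_distrib]
    have h3 := h1 ζ
    have h4 := hne ζ hζ
    simp only [hg]
    generalize (1 - Complex.I * ζ : ℂ) = a at h3 ⊢
    field_simp
  refine ⟨g, hgc, fun ζ => div_ne_zero (mul_ne_zero (hG0 ζ) (h2 ζ)) (h1 ζ), ?_, ?_, hgw⟩
  · have hfac : ∀ z ∈ Z, Tendsto (fun ζ : ClosedUpper => (ζ + z + Complex.I : ℂ) / (ζ - z))
        (comap (fun ζ : ClosedUpper => ‖(ζ : ℂ)‖) atTop) (𝓝 1) := by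
      intro z _
      have hcob : Tendsto (fun ζ : ClosedUpper => (ζ - z : ℂ))
          (comap (fun ζ : ClosedUpper => ‖(ζ : ℂ)‖) atTop) (Bornology.cobounded ℂ) := by
        rw [← tendsto_norm_atTop_iff_cobounded]
        refine tendsto_atTop_mono (fun ζ => norm_sub_norm_le _ _) ?_
        exact tendsto_atTop_add_const_right _ _ tendsto_comap
      have h3 := ((tendsto_inv₀_cobounded.comp hcob).const_mul (2 * z + Complex.I : ℂ)).const_add 1
      rw [mul_zero, add_zero] at h3
      refine h3.congr' ?_
      filter_upwards [hcob.eventually (Bornology.eventually_ne_cobounded (0 : ℂ))] with ζ hζ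
      simp only [Function.comp_apply]
      field_simp
      ring
    have h3 := (tendsto_jostFunction_div hV γ).mul (tendsto_finsetProd Z hfac)
    rw [Finset.prod_const_one, mul_one] at h3
    refine h3.congr' ?_
    have hbig : ∀ᶠ ζ : ClosedUpper in comap (fun ζ : ClosedUpper => ‖(ζ : ℂ)‖) atTop, ζ ∉ Z := by
      obtain ⟨M, hM⟩ := (Z.image fun z : ClosedUpper => ‖(z : ℂ)‖).bddAbove
      filter_upwards [tendsto_comap.eventually (eventually_gt_atTop M)] with ζ hζ hmem
      exact not_le.2 hζ (hM (Finset.mem_coe.2 (Finset.mem_image_of_mem _ hmem)))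
    filter_upwards [hbig] with ζ hζ
    exact (hgdiv ζ hζ).symm
  · -- By continuity it is enough to consider points of the imaginary axis other than the zeros.
    have hfin : {τ : ℝ | imagPoint τ ∈ Z}.Finite := by
      refine ((Z.finite_toSet.image fun z : ClosedUpper => (z : ℂ).im).union
        (Z.finite_toSet.image fun z : ClosedUpper => -(z : ℂ).im)).subset fun τ hτ => ?_
      rcases le_total 0 τ with h | h
      · exact Or.inl ⟨_, hτ, by simp [imagPoint, abs_of_nonneg h]⟩
      · exact Or.inr ⟨_, hτ, by simp [imagPoint, abs_of_nonpos h]⟩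
    have hdense : Dense {τ : ℝ | imagPoint τ ∈ Z}ᶜ := hfin.countable.dense_compl ℝ
    have hip : Continuous imagPoint := by
      unfold imagPoint
      have h : Continuous fun τ : ℝ => Complex.I * ((|τ| : ℝ) : ℂ) := by fun_prop
      exact h.subtype_mk _
    have hclosed : IsClosed {τ : ℝ | conj (g (imagPoint τ)) = g (imagPoint τ)} :=
      isClosed_eq (Complex.continuous_conj.comp (hgc.comp hip)) (hgc.comp hip)
    have hsub : {τ : ℝ | imagPoint τ ∈ Z}ᶜ ⊆
        {τ : ℝ | conj (g (imagPoint τ)) = g (imagPoint τ)} := by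
      intro τ hτ
      have h3 : conj (jostFunction V γ (imagPoint τ)) = jostFunction V γ (imagPoint τ) :=
        conj_jostFunction hV γ (abs_nonneg τ)
      have h4 : conj (1 - Complex.I * (imagPoint τ : ℂ)) = 1 - Complex.I * (imagPoint τ : ℂ) := by
        simp [imagPoint]
      rw [mem_ofPred_eq, hgdiv _ hτ, map_mul, map_div₀, h3, h4, map_prod]
      congr 1
      refine Finset.prod_congr rfl fun z hz => ?_
      have h5 := eq_I_mul_of_jostFunction_eq_zero hV ((mem_jostZeros hV).1 hz)
      rw [h5, show (imagPoint τ : ℂ) = Complex.I * (|τ| : ℝ) from rfl]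
      simp only [map_div₀, map_add, map_sub, map_mul, Complex.conj_I, Complex.conj_ofReal]
      rw [← neg_div_neg_eq]
      congr 1 <;> ring
    intro τ
    exact (hclosed.closure_subset_iff.2 hsub) (hdense τ)

end ZeroSet

/-! ### The limit phase -/

section Levinson

variable {V : ℝ → ℝ} (hV : IntegrableOn (fun x : ℝ => (1 + x) * V x) (Ioi 0) volume)
include hV

/-- The explicit part of the limit phase, which is the argument of
`(k + i) / (k + iγ) · ∏ (k - iκ) / (k + i(κ + 1))`. -/
def explicitPhase (γ : ℝ) (k : ℝ) : ℝ :=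
  (Real.arctan (1 / k) - Real.arctan (γ / k)) + ∑ z ∈ jostZeros hV γ,
    (Real.arctan (-(z : ℂ).im / k) - Real.arctan (((z : ℂ).im + 1) / k))

theorem continuousOn_explicitPhase (γ : ℝ) : ContinuousOn (explicitPhase hV γ) (Ioi 0) := by
  have h : ∀ c : ℝ, ContinuousOn (fun k : ℝ => Real.arctan (c / k)) (Ioi 0) := fun c =>
    Real.continuous_arctan.comp_continuousOn
      (continuousOn_const.div continuousOn_id fun k hk => (mem_Ioi.1 hk).ne')
  exact ((h _).sub (h _)).add (continuousOn_finsetSum _ fun z _ => (h _).sub (h _))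

theorem tendsto_explicitPhase_atTop (γ : ℝ) :
    Tendsto (explicitPhase hV γ) atTop (𝓝 0) := by
  have h := ((tendsto_arctan_div_atTop 1).sub (tendsto_arctan_div_atTop γ)).add
    (tendsto_finsetSum (jostZeros hV γ) fun z _ =>
      (tendsto_arctan_div_atTop (-(z : ℂ).im)).sub (tendsto_arctan_div_atTop ((z : ℂ).im + 1)))
  simp only [sub_self, Finset.sum_const_zero, add_zero] at h
  exact h

/-- The number of negative eigenvalues is the number of zeros on the positive imaginary axis. -/
theorem ncard_negEigenvalues (γ : ℝ) : (negEigenvalues V γ).ncard =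
    ((jostZeros hV γ).filter fun z : ClosedUpper => 0 < (z : ℂ).im).card := by
  rw [negEigenvalues_eq hV]
  have hinj : InjOn (fun κ : ℝ => -κ ^ 2)
      {κ : ℝ | 0 < κ ∧ jostFunction V γ (Complex.I * κ) = 0} := by
    intro a ha b hb hab
    simp only [neg_inj] at hab
    exact (pow_left_inj₀ ha.1.le hb.1.le two_ne_zero).1 hab
  rw [hinj.ncard_image, ← Set.ncard_coe_finset]
  have himg : {κ : ℝ | 0 < κ ∧ jostFunction V γ (Complex.I * κ) = 0} =
      (fun z : ClosedUpper => (z : ℂ).im) ''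
        ((jostZeros hV γ).filter fun z : ClosedUpper => 0 < (z : ℂ).im : Finset ClosedUpper) := by
    ext κ
    simp only [mem_image, Finset.mem_coe, Finset.mem_filter, mem_jostZeros, mem_ofPred_eq]
    constructor
    · rintro ⟨hκ, hw⟩
      exact ⟨⟨Complex.I * κ, by simpa using hκ.le⟩, ⟨hw, by simpa using hκ⟩, by simp⟩
    · rintro ⟨z, ⟨hz, hz0⟩, rfl⟩
      refine ⟨hz0, ?_⟩
      rw [← eq_I_mul_of_jostFunction_eq_zero hV hz]
      exact hz
  rw [himg, InjOn.ncard_image]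
  intro a ha b hb hab
  simp only [Finset.mem_coe, Finset.mem_filter, mem_jostZeros] at ha hb
  apply Subtype.ext
  rw [eq_I_mul_of_jostFunction_eq_zero hV ha.1, eq_I_mul_of_jostFunction_eq_zero hV hb.1]
  simp only at hab
  rw [hab]

theorem finite_negEigenvalues (γ : ℝ) : (negEigenvalues V γ).Finite := by
  rw [negEigenvalues_eq hV]
  refine Finite.image _ (((finite_zeros_jostFunction hV γ).image
    fun z : ClosedUpper => (z : ℂ).im).subset ?_)
  rintro κ ⟨hκ, hw⟩
  exact ⟨⟨Complex.I * κ, by simpa using hκ.le⟩, hw, by simp⟩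

/-- The only zero that is not on the positive imaginary axis can be `0`. -/
theorem card_filter_im_eq_zero (γ : ℝ) :
    ((jostZeros hV γ).filter fun z : ClosedUpper => ¬ 0 < (z : ℂ).im).card =
      if jostFunction V γ 0 = 0 then 1 else 0 := by
  have hmem : ∀ z : ClosedUpper, z ∈ (jostZeros hV γ).filter (fun z : ClosedUpper => ¬ 0 < (z : ℂ).im) ↔
      z = realPoint 0 ∧ jostFunction V γ 0 = 0 := by
    intro z
    rw [Finset.mem_filter, mem_jostZeros]
    constructor
    · rintro ⟨hz, him⟩
      have h0 : (z : ℂ) = 0 := by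
        rw [eq_I_mul_of_jostFunction_eq_zero hV hz, le_antisymm (not_lt.1 him) z.2]
        simp
      exact ⟨Subtype.ext (by simp [realPoint, h0]), h0 ▸ hz⟩
    · rintro ⟨rfl, hw⟩
      simpa [realPoint] using hw
  split_ifs with h
  · rw [Finset.card_eq_one]
    exact ⟨realPoint 0, by ext z; rw [hmem]; simp [h]⟩
  · rw [Finset.card_eq_zero]
    ext z
    rw [hmem]
    simp [h]

theorem tendsto_explicitPhase_zero (γ : ℝ) :
    Tendsto (explicitPhase hV γ) (𝓝[>] 0) (𝓝 (Real.pi / 2 - Real.pi / 2 * Real.sign γ -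
      Real.pi * (negEigenvalues V γ).ncard -
        Real.pi / 2 * (if jostFunction V γ 0 = 0 then 1 else 0))) := by
  have h := ((tendsto_arctan_div_zero 1).sub (tendsto_arctan_div_zero γ)).add
    (tendsto_finsetSum (jostZeros hV γ) fun z _ =>
      (tendsto_arctan_div_zero (-(z : ℂ).im)).sub (tendsto_arctan_div_zero ((z : ℂ).im + 1)))
  have hpos : ∑ z ∈ (jostZeros hV γ).filter (fun z : ClosedUpper => 0 < (z : ℂ).im),
      (Real.pi / 2 * Real.sign (-(z : ℂ).im) - Real.pi / 2 * Real.sign ((z : ℂ).im + 1)) =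
      -(Real.pi * (negEigenvalues V γ).ncard) := by
    rw [ncard_negEigenvalues hV, Finset.sum_congr rfl (g := fun _ => -Real.pi), Finset.sum_const,
      nsmul_eq_mul]
    · ring
    · intro z hz
      have h0 := (Finset.mem_filter.1 hz).2
      rw [Real.sign_of_neg (by linarith), Real.sign_of_pos (by linarith)]
      ring
  have hzero : ∑ z ∈ (jostZeros hV γ).filter (fun z : ClosedUpper => ¬ 0 < (z : ℂ).im),
      (Real.pi / 2 * Real.sign (-(z : ℂ).im) - Real.pi / 2 * Real.sign ((z : ℂ).im + 1)) =
      -(Real.pi / 2 * (if jostFunction V γ 0 = 0 then 1 else 0)) := by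
    rw [Finset.sum_congr rfl (g := fun _ => -(Real.pi / 2)), Finset.sum_const,
      card_filter_im_eq_zero hV]
    · split_ifs <;> simp
    · intro z hz
      have h0 := le_antisymm (not_lt.1 (Finset.mem_filter.1 hz).2) z.2
      rw [h0]
      simp
  rw [← Finset.sum_filter_add_sum_filter_not _ (fun z : ClosedUpper => 0 < (z : ℂ).im), hpos, hzero,
    Real.sign_one, mul_one] at h
  convert! h using 2
  ring

/-- A continuous limit phase vanishing at infinity, with explicit limit at `0`. -/
theorem exists_isLimitPhase (γ : ℝ) : ∃ η : ℝ → ℝ, IsLimitPhase V γ η ∧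
    Tendsto η atTop (𝓝 0) ∧ Tendsto η (𝓝[>] 0) (𝓝 (Real.pi / 2 - Real.pi / 2 * Real.sign γ -
      Real.pi * (negEigenvalues V γ).ncard -
        Real.pi / 2 * (if jostFunction V γ 0 = 0 then 1 else 0))) := by
  obtain ⟨g, hg, hg0, hlim, hreal, hw⟩ := exists_jostFunction_eq_mul hV γ
  obtain ⟨ψ, hψ, hψg, hψ0, hψ1⟩ := exists_phase_tendsto_zero hg hg0 hlim hreal
  refine ⟨fun k => ψ k + explicitPhase hV γ k,
    ⟨hψ.continuousOn.add (continuousOn_explicitPhase hV γ), fun k hk => ?_⟩, ?_, ?_⟩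
  · have hnum : (k + Complex.I * (γ : ℂ)) = Complex.I * (γ - Complex.I * k) := by
      linear_combination (k : ℂ) * Complex.I_sq
    have hγk : (γ - Complex.I * k : ℂ) ≠ 0 := fun h => by
      have := congrArg Complex.im h
      simp at this
      exact hk.ne' this
    have harg : IsArg (g (realPoint k) * (((k + Complex.I * (1 : ℝ)) / (k + Complex.I * γ)) *
        ∏ z ∈ jostZeros hV γ, (k + Complex.I * (-(z : ℂ).im : ℝ)) /
          (k + Complex.I * ((z : ℂ).im + 1 : ℝ)))) (ψ k + explicitPhase hV γ k) :=
      IsArg.mul (hψg k) (((isArg_add_mul_I hk 1).div (isArg_add_mul_I hk γ)).mul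
        (IsArg.prod _ fun z _ => (isArg_add_mul_I hk _).div (isArg_add_mul_I hk _)))
    have hprod : ∏ z ∈ jostZeros hV γ, (k + Complex.I * (-(z : ℂ).im : ℝ) : ℂ) /
          (k + Complex.I * ((z : ℂ).im + 1 : ℝ)) =
        ∏ z ∈ jostZeros hV γ, ((realPoint k : ℂ) - z) / (realPoint k + z + Complex.I) := by
      refine Finset.prod_congr rfl fun z hz => ?_
      have h5 := eq_I_mul_of_jostFunction_eq_zero hV ((mem_jostZeros hV).1 hz)
      rw [show (realPoint k : ℂ) = k from rfl]
      congr 1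
      · nth_rw 2 [h5]; push_cast; ring
      · nth_rw 2 [h5]; push_cast; ring
    have hquot : g (realPoint k) * (((k + Complex.I * (1 : ℝ)) / (k + Complex.I * γ)) *
        ∏ z ∈ jostZeros hV γ, (k + Complex.I * (-(z : ℂ).im : ℝ)) /
          (k + Complex.I * ((z : ℂ).im + 1 : ℝ))) =
        jostFunction V γ k / (γ - Complex.I * k) := by
      rw [hprod, show (k : ℂ) = (realPoint k : ℂ) from rfl, hw (realPoint k),
        show (realPoint k : ℂ) = k from rfl, hnum, eq_div_iff hγk]
      have h6 : (k + Complex.I * ((1 : ℝ) : ℂ)) = Complex.I * (1 - Complex.I * k) := by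
        push_cast
        linear_combination (k : ℂ) * Complex.I_sq
      rw [h6, mul_div_mul_left _ _ Complex.I_ne_zero]
      generalize (∏ z ∈ jostZeros hV γ, ((k : ℂ) - z) / (k + z + Complex.I)) = p
      generalize (1 - Complex.I * k : ℂ) = a
      field_simp
    rw [hquot, IsArg, div_eq_iff hγk, norm_div] at harg
    have hn : ‖(γ - Complex.I * k : ℂ)‖ = Real.sqrt (γ ^ 2 + k ^ 2) := by
      rw [Complex.norm_def, Complex.normSq_apply]
      congr 1
      simp [pow_two]
    rw [hn] at harg
    exact harg
  · simpa using hψ1.add (tendsto_explicitPhase_atTop hV γ)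
  · simpa only [zero_add] using hψ0.add (tendsto_explicitPhase_zero hV γ)

/-- Two limit phases differ by a constant. -/
theorem IsLimitPhase.exists_eq_add {γ : ℝ} {η₁ η₂ : ℝ → ℝ} (h₁ : IsLimitPhase V γ η₁)
    (h₂ : IsLimitPhase V γ η₂) : ∃ C : ℝ, ∀ k, 0 < k → η₁ k = η₂ k + C := by
  have h := eq_of_exp_eq_one isPreconnected_Ioi
    (h₁.continuousOn.sub h₂.continuousOn) (fun k hk => ?_)
  · refine ⟨η₁ 1 - η₂ 1, fun k hk => ?_⟩
    have := h k hk 1 (mem_Ioi.2 one_pos)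
    simp only [Pi.sub_apply] at this
    linarith
  · have hk' : (0 : ℝ) < k := hk
    have hw : jostFunction V γ k ≠ 0 :=
      jostFunction_ne_zero hV (by simp) (by simpa using hk'.ne')
    have e1 := h₁.eq_polar k hk'
    have e2 := h₂.eq_polar k hk'
    rw [e1] at hw
    obtain ⟨hw1, hγ⟩ := mul_ne_zero_iff.1 hw
    have ha := (mul_ne_zero_iff.1 hw1).1
    rw [e1] at e2
    have e3 := mul_left_cancel₀ ha (mul_right_cancel₀ hγ e2)
    rw [Pi.sub_apply, Complex.ofReal_sub, mul_sub, Complex.exp_sub, e3,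
      div_self (Complex.exp_ne_zero _)]

end Levinson

end RobinSchrodinger

end

theorem mainTheorem5 (V : ℝ → ℝ) (γ : ℝ)
    (hV : IntegrableOn (fun x : ℝ => (1 + x) * V x) (Ioi 0) volume)
    (N : ℕ) (hN : N = (RobinSchrodinger.negEigenvalues V γ).ncard) :
    -- there are finitely many negative eigenvalues, all of them simple
    (RobinSchrodinger.negEigenvalues V γ).Finite ∧
    (∀ lam ∈ RobinSchrodinger.negEigenvalues V γ, ∀ f g : RobinSchrodinger.L2,
      RobinSchrodinger.IsEigenvector V γ lam f → RobinSchrodinger.IsEigenvector V γ lam g →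
        ∃ c : ℂ, g = c • f) ∧
    -- the continuous limit phase exists, and can be normalized to vanish at infinity
    (∃ η : ℝ → ℝ, RobinSchrodinger.IsLimitPhase V γ η ∧ Tendsto η atTop (𝓝 0)) ∧
    -- its limits at zero and at infinity exist and satisfy the Levinson formula
    (∀ η : ℝ → ℝ, RobinSchrodinger.IsLimitPhase V γ η →
      ∃ η₀ ηinf : ℝ, Tendsto η (𝓝[>] 0) (𝓝 η₀) ∧ Tendsto η atTop (𝓝 ηinf) ∧
        (RobinSchrodinger.jostFunction V γ 0 ≠ 0 →
          (0 < γ → ηinf - η₀ = Real.pi * (N : ℝ)) ∧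
          (γ = 0 → ηinf - η₀ = Real.pi * ((N : ℝ) - 1 / 2)) ∧
          (γ < 0 → ηinf - η₀ = Real.pi * ((N : ℝ) - 1))) ∧
        (RobinSchrodinger.jostFunction V γ 0 = 0 →
          (0 < γ → ηinf - η₀ = Real.pi * ((N : ℝ) + 1 / 2)) ∧
          (γ = 0 → ηinf - η₀ = Real.pi * (N : ℝ)) ∧
          (γ < 0 → ηinf - η₀ = Real.pi * ((N : ℝ) - 1 / 2)))) := by
  subst hN
  obtain ⟨η₁, h₁, hinf, hzero⟩ := RobinSchrodinger.exists_isLimitPhase hV γ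
  refine ⟨RobinSchrodinger.finite_negEigenvalues hV γ, fun lam hlam f g hf hg =>
    RobinSchrodinger.exists_smul_eq_of_mem_negEigenvalues hV hlam.1 hf hg,
    ⟨η₁, h₁, hinf⟩, fun η hη => ?_⟩
  obtain ⟨C, hC⟩ := hη.exists_eq_add hV h₁
  refine ⟨_, 0 + C, (hzero.add_const C).congr' ?_, (hinf.add_const C).congr' ?_,
    fun hw => ⟨fun hγ => ?_, fun hγ => ?_, fun hγ => ?_⟩,
    fun hw => ⟨fun hγ => ?_, fun hγ => ?_, fun hγ => ?_⟩⟩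
  · filter_upwards [self_mem_nhdsWithin] with k hk
    exact (hC k hk).symm
  · filter_upwards [eventually_gt_atTop 0] with k hk
    exact (hC k hk).symm
  · rw [if_neg hw, Real.sign_of_pos hγ]; ring
  · rw [if_neg hw, hγ, Real.sign_zero]; ring
  · rw [if_neg hw, Real.sign_of_neg hγ]; ring
  · rw [if_pos hw, Real.sign_of_pos hγ]; ring
  · rw [if_pos hw, hγ, Real.sign_zero]; ring
  · rw [if_pos hw, Real.sign_of_neg hγ]; ring
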